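/- Let $S=\{s_1,\dots,s_n\}$, $n\ge 1$, be a finite set of non-degenerate straight line segments in the plane $\mathbb R^2$, each given by its two end points, such that any two different collinear segments of $S$ have at most one point in common. Let $I$ be the set of all points that lie on at least two different segments of $S$, let $J$ be the set of all end points of segments of $S$, put $V=I\cup J$ and $p=|V|$, and for $v\in V$ let $S_v$ be the set of the segments of $S$ that contain $v$. Let $G=(V,E)$ be the plane graph embedded as $\bar S=\bigcup_{s\in S}s$: two different vertices $u,v\in V$ are joined by an edge if and only if the straight line segment $\overline{uv}$ is contained in $\bar S$ and has no vertex in its relative interior. For $s\in S$ let $E_s$ be the set of the edges of $G$ that are contained in $s$. Procedure (B) works as follows on the input $S$. 1. By a plane sweep in the manner of Bentley and Ottmann (with an event queue and a status structure kept in balanced search trees), compute all vertices $v_1,\dots,v_p$ of $V$ together with the lists $S_{v_1},\dots,S_{v_p}$. 2. Initialize $n$ lists $L_1,\dots,L_n$, one for each segment, to empty. 3. Read consecutively $S_{v_1},\dots,S_{v_p}$; whenever the segment $s_k$ is met in the list $S_{v_j}$, add to $L_k$ an element $l(i,j)$, where $i$ is its consecutive number in $L_k$. 4. Sort each list $L_k$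 by the positions of the vertices $v_j$ along $s_k$. 5. For every $k$, output the list of the edges that join consecutive vertices in the sorted list $L_k$. Then Procedure (B) is correct: for every $k$ its output for $s_k$ lists each edge in $E_{s_k}$ exactly once, and nothing else, in the order in which the edges are met on the way along $s_k$ from its first given end point to the second. Moreover its running time is $O(p\log p)$: there is an absolute constant $C$ such that on each such input the procedure performs at most $C\,p\log p$ elementary steps of a real RAM (arithmetic operations and comparisons of real numbers, and list, tree and array cell accesses, each at unit cost). -/

import Mathlib

/-! ## Timed programs on a unit-cost real RAM

A value of type `Timed α` is a result together with the number of elementary steps spent on it.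
All running time is charged through `step`: one elementary step stands for a bounded number of
operations of a real RAM, namely field operations and comparisons of coordinates, arithmetic on
counters, building or inspecting a bounded number of list, tree or record cells, and reading or
writing a bounded number of array cells.  Arrays are modelled by functions on their index type.
Every program below performs only a bounded number of such operations per elementary step: each
recursive program spends at least one step per call, and no unbounded operation is performed
outside of a timed program.  (The list `List.finRange n` only serves as the range of loops over
the indices of the `n` segments.) -/

namespace GuardSegments

/-- A result together with the number of elementary steps used to produce it. -/
structure Timed (α : Type) where
  val : α
  time : ℕ

namespace Timed

instance instMonad : Monad Timed where
  pure a := ⟨a, 0⟩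
  bind x f := ⟨(f x.val).val, x.time + (f x.val).time⟩

end Timed

/-- One elementary step. -/
def step {α : Type} (a : α) : Timed α := ⟨a, 1⟩

/-- Allocation of an array with `n` cells, each holding `a`; it takes `n` steps. -/
def newArray {α : Type} (n : ℕ) (a : α) : Timed (Fin n → α) := ⟨fun _ => a, n⟩

/-- Concatenation of lists. -/
def append {α : Type} : List α → List α → Timed (List α)
  | [], ys => step ys
  | x :: xs, ys => do
    let zs ← append xs ys
    step (x :: zs)

/-! ### Balanced search trees (AVL trees)

A search in a tree is directed by a function `cmp`, which tells whether the position searched for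
is before (`lt`), at (`eq`) or after (`gt`) a given entry of the tree. -/

/-- Binary trees; every inner node stores its height. -/
inductive AVL (α : Type) where
  | nil : AVL α
  | node (h : ℕ) (l : AVL α) (x : α) (r : AVL α) : AVL α

namespace AVL

variable {α : Type}

/-- The stored height (a single read). -/
def height : AVL α → ℕ
  | nil => 0
  | node h _ _ _ => h

/-- A node with its height filled in. -/
def mk (l : AVL α) (x : α) (r : AVL α) : AVL α := node (max l.height r.height + 1) l x r

/-- A node whose left subtree may be too high by one: single or double rotation. -/
def rotateRight (l : AVL α) (x : α) (r : AVL α) : AVL α :=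
  match l with
  | nil => mk nil x r
  | node _ ll lx lr =>
    if lr.height ≤ ll.height then mk ll lx (mk lr x r)
    else match lr with
      | nil => mk ll lx (mk nil x r)
      | node _ m y m' => mk (mk ll lx m) y (mk m' x r)

/-- A node whose right subtree may be too high by one: single or double rotation. -/
def rotateLeft (l : AVL α) (x : α) (r : AVL α) : AVL α :=
  match r with
  | nil => mk l x nil
  | node _ rl rx rr =>
    if rl.height ≤ rr.height then mk (mk l x rl) rx rr
    else match rl with
      | nil => mk (mk l x nil) rx rr
      | node _ m y m' => mk (mk l x m) y (mk m' rx rr)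

/-- A balanced node, from subtrees whose heights differ by at most two. -/
def balance (l : AVL α) (x : α) (r : AVL α) : AVL α :=
  if r.height + 1 < l.height then rotateRight l x r
  else if l.height + 1 < r.height then rotateLeft l x r
  else mk l x r

/-- Insert `new` at the position given by `cmp`; an entry that is already there is instead
modified by `upd`. -/
def insert (cmp : α → Timed Ordering) (new : α) (upd : α → α) : AVL α → Timed (AVL α)
  | nil => step (mk nil new nil)
  | node h l x r => do
    match ← cmp x with
    | .lt => do
      let l' ← insert cmp new upd l
      step (balance l' x r)
    | .eq => step (node h l (upd x) r)
    | .gt => do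
      let r' ← insert cmp new upd r
      step (balance l x r')

/-- Remove and return the first entry, if there is one. -/
def popMin : AVL α → Timed (Option (α × AVL α))
  | nil => step none
  | node _ l x r => do
    match ← popMin l with
    | none => step (some (x, r))
    | some (y, l') => step (some (y, balance l' x r))

/-- Remove and return an entry at the position given by `cmp`, if there is one. -/
def remove (cmp : α → Timed Ordering) : AVL α → Timed (Option (α × AVL α))
  | nil => step none
  | node _ l x r => do
    match ← cmp x with
    | .lt => do
      match ← remove cmp l with
      | none => step none
      | some (y, l') => step (some (y, balance l' x r))
    | .eq => do
      match ← popMin r with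
      | none => step (some (x, l))
      | some (y, r') => step (some (x, balance l y r'))
    | .gt => do
      match ← remove cmp r with
      | none => step none
      | some (y, r') => step (some (y, balance l x r'))

/-- The last entry before the position given by `cmp`, if there is one, and `best` otherwise. -/
def findBefore (cmp : α → Timed Ordering) (best : Option α) : AVL α → Timed (Option α)
  | nil => step best
  | node _ l x r => do
    match ← cmp x with
    | .gt => findBefore cmp (some x) r
    | _ => findBefore cmp best l

/-- The first entry after the position given by `cmp`, if there is one, and `best` otherwise. -/
def findAfter (cmp : α → Timed Ordering) (best : Option α) : AVL α → Timed (Option α)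
  | nil => step best
  | node _ l x r => do
    match ← cmp x with
    | .lt => findAfter cmp (some x) l
    | _ => findAfter cmp best r

/-- The list of the entries of a tree, in front of `acc`. -/
def flatten : AVL α → List α → Timed (List α)
  | nil, acc => step acc
  | node _ l x r, acc => do
    let acc' ← flatten r acc
    flatten l (x :: acc')

/-- Insert all entries of a list. -/
def insertAll (cmp : α → α → Timed Ordering) : List α → AVL α → Timed (AVL α)
  | [], t => step t
  | x :: xs, t => do
    let t' ← t.insert (cmp x) x id
    insertAll cmp xs t'

end AVL

/-- Sort a list (of pairwise inequivalent entries). -/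
def sort {α : Type} (cmp : α → α → Timed Ordering) (xs : List α) : Timed (List α) := do
  let t ← AVL.insertAll cmp xs AVL.nil
  t.flatten []

/-! ### Points and segments: primitives with boundedly many arithmetic operations -/

/-- A straight line segment, given by its two end points. -/
structure Segment (K : Type) where
  a : K × K
  b : K × K

section Primitives

variable {K : Type} [Field K] [LinearOrder K]

/-- Lexicographic comparison of points: the order in which the plane is swept. -/
def lexCmp (u v : K × K) : Ordering := (compare u.1 v.1).then (compare u.2 v.2)

/-- The end point that is swept first. -/
def Segment.lo (s : Segment K) : K × K := if lexCmp s.a s.b = .gt then s.b else s.a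

/-- The end point that is swept last. -/
def Segment.hi (s : Segment K) : K × K := if lexCmp s.a s.b = .gt then s.a else s.b

def cross (u v : K × K) : K := u.1 * v.2 - u.2 * v.1

def Segment.dir (s : Segment K) : K × K := s.hi - s.lo

/-- Is the point `q` below (`lt`), on (`eq`) or above (`gt`) the line of `s`? -/
def Segment.side (s : Segment K) (q : K × K) : Ordering := compare (cross s.dir (q - s.lo)) 0

/-- Comparison of the slopes of `s` and `t`. -/
def Segment.slopeCmp (s t : Segment K) : Ordering := compare (cross t.dir s.dir) 0

/-- The common point of two non-parallel segments, if there is one. -/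
def Segment.meet (s t : Segment K) : Option (K × K) :=
  let den := cross s.dir t.dir
  let x := cross (t.lo - s.lo) t.dir / den
  let y := cross (t.lo - s.lo) s.dir / den
  if den ≠ 0 ∧ 0 ≤ x ∧ x ≤ 1 ∧ 0 ≤ y ∧ y ≤ 1 then
    some (s.lo.1 + x * s.dir.1, s.lo.2 + x * s.dir.2)
  else none

/-- Comparison of the positions of `u` and `v` along `s`, from `s.a` to `s.b`. -/
def Segment.alongCmp (s : Segment K) (u v : K × K) : Ordering :=
  compare ((s.b - s.a).1 * u.1 + (s.b - s.a).2 * u.2) ((s.b - s.a).1 * v.1 + (s.b - s.a).2 * v.2)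

end Primitives

/-! ### Procedure (A): plane sweep in the manner of Bentley and Ottmann

Input: an array of segments.  Output: the list of all vertices `v` (end points and intersection
points), each with the list of (the indices of) all segments that contain `v`.

The event queue is a search tree of points in lexicographic order, each with the list of the
segments that start there.  The status is a search tree of the segments that are met by the sweep
line, from bottom to top. -/

section ProcedureA

variable {K : Type} [Field K] [LinearOrder K] {n : ℕ}

/-- Put a point into the event queue, unless it is there already. -/
def addPoint (q : K × K) (Q : AVL ((K × K) × List (Fin n))) :
    Timed (AVL ((K × K) × List (Fin n))) :=
  Q.insert (fun e => step (lexCmp q e.1)) (q, []) id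

/-- Record in the event queue that segment `k` starts at `q`. -/
def addStart (q : K × K) (k : Fin n) (Q : AVL ((K × K) × List (Fin n))) :
    Timed (AVL ((K × K) × List (Fin n))) :=
  Q.insert (fun e => step (lexCmp q e.1)) (q, [k]) (fun e => (e.1, k :: e.2))

/-- Put the end points of the listed segments into the event queue. -/
def initQueue (s : Fin n → Segment K) :
    List (Fin n) → AVL ((K × K) × List (Fin n)) → Timed (AVL ((K × K) × List (Fin n)))
  | [], Q => step Q
  | k :: ks, Q => do
    let Q₁ ← addStart (s k).lo k Q
    let Q₂ ← addPoint (s k).hi Q₁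
    initQueue s ks Q₂

/-- Remove from the status the segments through `q`, at most `fuel` of them; return them and the
remaining status. -/
def extract (s : Fin n → Segment K) (q : K × K) :
    ℕ → AVL (Fin n) → Timed (List (Fin n) × AVL (Fin n))
  | 0, T => step ([], T)
  | fuel + 1, T => do
    match ← T.remove (fun k => step ((s k).side q)) with
    | none => step ([], T)
    | some (k, T') => do
      let r ← extract s q fuel T'
      step (k :: r.1, r.2)

/-- Put those of the listed segments that do not end at `q` in front of `acc`. -/
def survivors (s : Fin n → Segment K) (q : K × K) :
    List (Fin n) → List (Fin n) → Timed (List (Fin n))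
  | [], acc => step acc
  | k :: ks, acc => do
    let acc' ← step (if (s k).hi = q then acc else k :: acc)
    survivors s q ks acc'

/-- Position of segment `k`, which contains `q`, relative to segment `j` on the sweep line
immediately after `q`. -/
def statusCmp (s : Fin n → Segment K) (q : K × K) (k j : Fin n) : Timed Ordering :=
  step (((s j).side q).then ((s k).slopeCmp (s j)))

/-- Schedule the intersection points, later than `q`, of segment `o` (if any) with the listed
segments. -/
def schedule (s : Fin n → Segment K) (q : K × K) (o : Option (Fin n)) :
    List (Fin n) → AVL ((K × K) × List (Fin n)) → Timed (AVL ((K × K) × List (Fin n)))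
  | [], Q => step Q
  | k :: ks, Q => do
    match ← step (o.bind fun j => (s j).meet (s k)) with
    | none => schedule s q o ks Q
    | some v => do
      let Q' ← if lexCmp q v = .lt then addPoint v Q else step Q
      schedule s q o ks Q'

/-- The result of processing one event point: the segments through it, the new event queue and
the new status. -/
structure Handled (K : Type) (n : ℕ) where
  through : List (Fin n)
  queue : AVL ((K × K) × List (Fin n))
  status : AVL (Fin n)

/-- Process the event point `q`, at which the segments in `start` begin. -/
def handle (s : Fin n → Segment K) (q : K × K) (start : List (Fin n))
    (Q : AVL ((K × K) × List (Fin n))) (T : AVL (Fin n)) : Timed (Handled K n) := do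
  let r ← extract s q n T
  let below ← r.2.findBefore (fun k => step ((s k).side q)) none
  let above ← r.2.findAfter (fun k => step ((s k).side q)) none
  let new ← survivors s q r.1 start
  let T' ← AVL.insertAll (statusCmp s q) new r.2
  let Q' ← match new with
    | [] => schedule s q below above.toList Q
    | _ => do
      let Q₁ ← schedule s q below new Q
      schedule s q above new Q₁
  let through ← append r.1 start
  step ⟨through, Q', T'⟩

/-- The main loop: process the event points in order, until the queue is empty, but at most
`fuel` of them. -/
def sweep (s : Fin n → Segment K) :
    ℕ → AVL ((K × K) × List (Fin n)) → AVL (Fin n) → Timed (List ((K × K) × List (Fin n)))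
  | 0, _, _ => step []
  | fuel + 1, Q, T => do
    match ← Q.popMin with
    | none => step []
    | some (e, Q') => do
      let h ← handle s e.1 e.2 Q' T
      let rest ← sweep s fuel h.queue h.status
      step ((e.1, h.through) :: rest)

/-- Procedure (A).  There are at most `n * n + 2 * n` vertices. -/
def procedureA (s : Fin n → Segment K) : Timed (List ((K × K) × List (Fin n))) := do
  let Q ← initQueue s (List.finRange n) AVL.nil
  sweep s (n * n + 2 * n) Q AVL.nil

end ProcedureA

/-! ### Procedure (B): the edges on every segment -/

section ProcedureB

variable {K : Type} [Field K] [LinearOrder K] {n : ℕ}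

/-- An element `l(i, j)` of a list `L_k`: its number `i` in `L_k` and the index `j` of a vertex;
the vertex `v = v_j` is kept with its index. -/
structure Entry (K : Type) where
  i : ℕ
  j : ℕ
  v : K × K

/-- Add an element for the vertex `v = v_j` to the list `L_k`. -/
def addEntry (j : ℕ) (v : K × K) (k : Fin n) (L : Fin n → List (Entry K)) :
    Fin n → List (Entry K) :=
  Function.update L k
    (match L k with
      | [] => [⟨1, j, v⟩]
      | e :: es => ⟨e.i + 1, j, v⟩ :: e :: es)

/-- Read the list `S_v` of the segments through the vertex `v = v_j`. -/
def readVertex (j : ℕ) (v : K × K) :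
    List (Fin n) → (Fin n → List (Entry K)) → Timed (Fin n → List (Entry K))
  | [], L => step L
  | k :: ks, L => do
    let L' ← step (addEntry j v k L)
    readVertex j v ks L'

/-- Read consecutively the lists `S_v` of all vertices `v = v_j, v_{j+1}, …`. -/
def readAll : ℕ → List ((K × K) × List (Fin n)) → (Fin n → List (Entry K)) →
    Timed (Fin n → List (Entry K))
  | _, [], L => step L
  | j, (v, ks) :: rest, L => do
    let L' ← readVertex j v ks L
    readAll (j + 1) rest L'

/-- Sort the lists `L_k`, for the listed `k`, by the positions of the vertices along the segment
`k`. -/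
def sortAll (s : Fin n → Segment K) :
    List (Fin n) → (Fin n → List (Entry K)) → Timed (Fin n → List (Entry K))
  | [], L => step L
  | k :: ks, L => do
    let l ← sort (fun e f => step ((s k).alongCmp e.v f.v)) (L k)
    let L' ← step (Function.update L k l)
    sortAll s ks L'

/-- The edges between consecutive vertices of a list. -/
def consecutive : List (Entry K) → Timed (List ((K × K) × (K × K)))
  | e :: f :: es => do
    let r ← consecutive (f :: es)
    step ((e.v, f.v) :: r)
  | _ => step []

/-- Reconstruct the lists of edges on the listed segments. -/
def edgesAll (L : Fin n → List (Entry K)) :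
    List (Fin n) → (Fin n → List ((K × K) × (K × K))) →
      Timed (Fin n → List ((K × K) × (K × K)))
  | [], E => step E
  | k :: ks, E => do
    let l ← consecutive (L k)
    let E' ← step (Function.update E k l)
    edgesAll L ks E'

/-- Procedure (B).  Input: an array of `n` segments.  Output: for every segment, the list of the
edges on it, every edge being given by its two end points. -/
def procedureB (s : Fin n → Segment K) : Timed (Fin n → List ((K × K) × (K × K))) := do
  let A ← procedureA s
  let L₀ ← newArray n []
  let L₁ ← readAll 1 A L₀
  let L₂ ← sortAll s (List.finRange n) L₁
  let E₀ ← newArray n []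
  edgesAll L₂ (List.finRange n) E₀

end ProcedureB

/-! ## The plane graph of a set of segments -/

section Geometry

variable {n : ℕ}

/-- The set of the points of a segment. -/
def Segment.points (s : Segment ℝ) : Set (ℝ × ℝ) := segment ℝ s.a s.b

/-- The standing assumptions on the segments: they are non-degenerate, and two different collinear
segments have at most one point in common. -/
structure Admissible (s : Fin n → Segment ℝ) : Prop where
  nondegenerate : ∀ k, (s k).a ≠ (s k).b
  collinear : ∀ i j, i ≠ j → Collinear ℝ ((s i).points ∪ (s j).points) →
    ((s i).points ∩ (s j).points).Subsingleton

/-- The union of the segments. -/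
def allPoints (s : Fin n → Segment ℝ) : Set (ℝ × ℝ) := ⋃ k, (s k).points

/-- The set `I` of the intersection points. -/
def intersections (s : Fin n → Segment ℝ) : Set (ℝ × ℝ) :=
  {v | ∃ i j, i ≠ j ∧ v ∈ (s i).points ∧ v ∈ (s j).points}

/-- The set `J` of the end points. -/
def endpoints (s : Fin n → Segment ℝ) : Set (ℝ × ℝ) := {v | ∃ k, v = (s k).a ∨ v = (s k).b}

/-- The set `V = I ∪ J` of the vertices. -/
def vertices (s : Fin n → Segment ℝ) : Set (ℝ × ℝ) := intersections s ∪ endpoints s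

/-- The plane graph with vertex set `V` that is embedded as the union of the segments: its edges
are the straight line segments in that union that join two different vertices and have no vertex
in between. -/
def planeGraph (s : Fin n → Segment ℝ) : SimpleGraph (vertices s) where
  Adj u v := u ≠ v ∧ segment ℝ (u : ℝ × ℝ) v ⊆ allPoints s ∧
    Disjoint (openSegment ℝ (u : ℝ × ℝ) v) (vertices s)
  symm := ⟨fun u v ⟨h, h₁, h₂⟩ => ⟨h.symm, by rwa [segment_symm], by rwa [openSegment_symm]⟩⟩
  loopless := ⟨fun _ h => h.1 rfl⟩

/-- The set of the edges of the plane graph that are contained in segment `k`, every edge being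
given by the unordered pair of its end points. -/
def edgesOn (s : Fin n → Segment ℝ) (k : Fin n) : Set (Sym2 (ℝ × ℝ)) :=
  {e | ∃ u v : vertices s, (planeGraph s).Adj u v ∧
    segment ℝ (u : ℝ × ℝ) v ⊆ (s k).points ∧ e = s((u : ℝ × ℝ), (v : ℝ × ℝ))}

/-- `E` lists every edge on segment `k` exactly once, in the order in which the edges are met on
the way from the end point `(s k).a` to the other end point; the end points of every edge are
listed in the same order. -/
structure IsOrderedEdgeList (s : Fin n → Segment ℝ) (k : Fin n)
    (E : List ((ℝ × ℝ) × (ℝ × ℝ))) : Prop where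
  mem_iff : ∀ e, e ∈ edgesOn s k ↔ e ∈ E.map (fun uv => s(uv.1, uv.2))
  nodup : (E.map (fun uv => s(uv.1, uv.2))).Nodup
  oriented : ∀ uv ∈ E, uv.1 ∈ segment ℝ (s k).a uv.2
  ordered : E.Pairwise (fun uv uv' => uv.2 ∈ segment ℝ (s k).a uv'.1)

end Geometry

end GuardSegments

/-!
The proof follows the plane sweep. Points are swept in the lexicographic order,
`toLex u < toLex v`, and `LexPos` vectors are those that point forward in it; all arguments about
the positions of segments are sign computations with `cross`, in which vertical segments play
no special role.

*Status.* After the event point `q`, the status lists the segments with `lo ≤ q < hi`. That `S`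
comes before `T` in it means `Below q S T`: every later point that the two segments reach before
their next common point is on compatible sides of them. This relation persists by its very form
while no common point is swept (`Below.mono`), holds for segments through `q` ordered by slope
(`below_of_slopes`), and holds if `q` separates the two segments (`below_of_sides`): a later point
on the wrong sides would lie, together with `q`, in the double cone at the intersection point of
the two lines, so this point would be swept in between. Hence a search in the status for the next
vertex is correctly directed, and the segments through this vertex are consecutive in it. In
particular, a vertex that is not an end point is a common point of two neighbours; as the
intersection points of neighbours are scheduled, the head of the queue is always the next vertex
(`SweepInv.nextVertex_head`). So the sweep finds all vertices, each with the segments through it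
(`handle_spec`, `sweep_spec`).

*Linear size.* The total length of the lists of segments through the vertices is at most `6 p`.
This replaces the bound on the number of edges of a plane graph and is proved by a potential:
`crossed` counts the pairs of neighbours in the status with a common point that has been swept. If
`m` segments leave an event point to the right, then `m - 1` new such pairs arise, while at most
two old ones are lost, since segments that meet in the event point have no earlier common point
(`SweepInv.status_step`). As the status is empty in the end, the numbers `m` sum up to at most
`3 p`, and so do the numbers of the segments that are removed from the status. The time spent on an event
point is `O(log p)` times the number of segments through it plus one, and the same potential
bounds the sum.

*Edges.* The list of a segment holds exactly the vertices on it. Sorted along the segment, its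
consecutive entries are the edges, because an edge is a pair of vertices with no vertex in between
(`isOrderedEdgeList_zip_tail`). Sorting lists of total length at most `6 p` takes `O(p log p)`
steps.
-/

namespace GuardSegments

/-! ### Timed programs -/

namespace Timed

@[simp] theorem bind_val {α β : Type} (x : Timed α) (f : α → Timed β) :
    (x >>= f).val = (f x.val).val := rfl

@[simp] theorem bind_time {α β : Type} (x : Timed α) (f : α → Timed β) :
    (x >>= f).time = x.time + (f x.val).time := rfl

end Timed

@[simp] theorem step_val {α : Type} (a : α) : (step a).val = a := rfl

@[simp] theorem step_time {α : Type} (a : α) : (step a).time = 1 := rfl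

@[simp] theorem append_val {α : Type} (xs ys : List α) : (append xs ys).val = xs ++ ys := by
  induction xs with
  | nil => rfl
  | cons x xs ih => simp [append, ih]

@[simp] theorem append_time {α : Type} (xs ys : List α) :
    (append xs ys).time = xs.length + 1 := by
  induction xs with
  | nil => rfl
  | cons x xs ih => simp [append, ih]

/-! ### Balanced search trees -/

/-- A comparator `c` directs a search in the list `l`: the entries that the searched position is
after come first, then the entries at that position, then the entries that it is before. -/
def Directed {α : Type} (c : α → Ordering) (l : List α) : Prop :=
  l.Pairwise fun x y => (c y = .gt → c x = .gt) ∧ (c x = .lt → c y = .lt)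

/-- A directed list splits into the entries before, at and after the searched position. -/
theorem Directed.eq_append {α : Type} {c : α → Ordering} {l : List α} (h : Directed c l) :
    l = l.filter (fun x => c x = .gt) ++ l.filter (fun x => c x = .eq) ++
      l.filter (fun x => c x = .lt) := by
  induction l with
  | nil => rfl
  | cons x l ih =>
    obtain ⟨hx, hl⟩ := List.pairwise_cons.1 h
    have ih := ih hl
    have hnil : ∀ o : Ordering, (∀ y ∈ l, c y ≠ o) → l.filter (fun y => c y = o) = [] := by
      intro o ho
      simpa [List.filter_eq_nil_iff] using ho
    cases hc : c x
    · have h1 := hnil .gt (fun y hy => by simp [(hx y hy).2 hc])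
      have h2 := hnil .eq (fun y hy => by simp [(hx y hy).2 hc])
      rw [h1, h2] at ih
      simpa [hc, h1, h2] using ih
    · have h1 := hnil .gt (fun y hy hg => by simp [(hx y hy).1 hg] at hc)
      rw [h1] at ih
      simpa [hc, h1] using ih
    · simpa [hc] using ih

namespace AVL

variable {α : Type}

/-- The entries of a tree, from left to right. -/
def toList : AVL α → List α
  | nil => []
  | node _ l x r => l.toList ++ x :: r.toList

/-- The stored heights are correct, and the tree is balanced in the sense of AVL trees. -/
def Bal : AVL α → Prop
  | nil => True
  | node h l _ r => l.Bal ∧ r.Bal ∧ h = max l.height r.height + 1 ∧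
      l.height ≤ r.height + 1 ∧ r.height ≤ l.height + 1

@[simp] theorem toList_nil : (nil : AVL α).toList = [] := rfl

@[simp] theorem toList_node (h : ℕ) (l : AVL α) (x : α) (r : AVL α) :
    (node h l x r).toList = l.toList ++ x :: r.toList := rfl

@[simp] theorem height_nil : (nil : AVL α).height = 0 := rfl

@[simp] theorem height_node (h : ℕ) (l : AVL α) (x : α) (r : AVL α) :
    (node h l x r).height = h := rfl

theorem Bal.two_pow_height_le {t : AVL α} (ht : t.Bal) :
    2 ^ t.height ≤ (t.toList.length + 1) ^ 2 := by
  induction t with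
  | nil => simp
  | node h l x r ihl ihr =>
    obtain ⟨hl, hr, rfl, h1, h2⟩ := ht
    have il := ihl hl
    have ir := ihr hr
    simp only [height_node, toList_node, List.length_append, List.length_cons]
    have key : ∀ m : ℕ, m ≤ l.height → m ≤ r.height → max l.height r.height ≤ m + 1 →
        2 ^ (max l.height r.height + 1) ≤ (l.toList.length + (r.toList.length + 1) + 1) ^ 2 := by
      intro m hml hmr hm
      have e1 : 2 ^ (max l.height r.height + 1) ≤ 2 ^ (m + 2) :=
        Nat.pow_le_pow_right (by norm_num) (by omega)
      have e2 : 2 ^ m ≤ (l.toList.length + 1) ^ 2 :=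
        (Nat.pow_le_pow_right (by norm_num) hml).trans il
      have e3 : 2 ^ m ≤ (r.toList.length + 1) ^ 2 :=
        (Nat.pow_le_pow_right (by norm_num) hmr).trans ir
      have e4 : 2 ^ (m + 2) = 4 * 2 ^ m := by ring
      rcases le_total l.toList.length r.toList.length with h | h
      · nlinarith
      · nlinarith
    exact key (min l.height r.height) (min_le_left _ _) (min_le_right _ _) (by omega)

/-- A bound for the height of a balanced tree with at most `N` entries. -/
def heightBound (N : ℕ) : ℕ := 2 * Nat.log 2 (N + 1) + 1

theorem heightBound_mono {M N : ℕ} (h : M ≤ N) : heightBound M ≤ heightBound N := by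
  have := Nat.log_mono_right (b := 2) (Nat.add_le_add_right h 1)
  unfold heightBound
  omega

theorem Bal.height_le {t : AVL α} (ht : t.Bal) {N : ℕ} (hN : t.toList.length ≤ N) :
    t.height ≤ heightBound N := by
  refine le_trans ?_ (heightBound_mono hN)
  have h1 := ht.two_pow_height_le
  have h2 : t.toList.length + 1 < 2 ^ (Nat.log 2 (t.toList.length + 1) + 1) :=
    Nat.lt_pow_succ_log_self (by norm_num) _
  have h3 : 2 ^ t.height < 2 ^ (2 * (Nat.log 2 (t.toList.length + 1) + 1)) := by
    calc 2 ^ t.height ≤ (t.toList.length + 1) ^ 2 := h1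
      _ < (2 ^ (Nat.log 2 (t.toList.length + 1) + 1)) ^ 2 := Nat.pow_lt_pow_left h2 (by norm_num)
      _ = _ := by rw [← pow_mul, mul_comm]
  have h4 := (Nat.pow_lt_pow_iff_right (by norm_num : 1 < 2)).1 h3
  unfold heightBound
  omega

theorem toList_balance (l : AVL α) (x : α) (r : AVL α) :
    (balance l x r).toList = l.toList ++ x :: r.toList := by
  unfold balance rotateRight rotateLeft
  split_ifs
  · rcases l with _ | ⟨hl, ll, lx, lr⟩
    · simp [mk]
    · rcases lr with _ | ⟨_, m, y, m'⟩ <;> dsimp only <;> split_ifs <;> simp [mk]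
  · rcases r with _ | ⟨hr, rl, rx, rr⟩
    · simp [mk]
    · rcases rl with _ | ⟨_, m, y, m'⟩ <;> dsimp only <;> split_ifs <;> simp [mk]
  · simp [mk]

theorem balance_spec {l : AVL α} (x : α) {r : AVL α} (hl : l.Bal) (hr : r.Bal)
    (h1 : l.height ≤ r.height + 2) (h2 : r.height ≤ l.height + 2) :
    (balance l x r).Bal ∧ max l.height r.height ≤ (balance l x r).height ∧
      (balance l x r).height ≤ max l.height r.height + 1 ∧
      (l.height ≤ r.height + 1 → r.height ≤ l.height + 1 →
        (balance l x r).height = max l.height r.height + 1) := by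
  unfold balance rotateRight rotateLeft
  split_ifs with c1 c2
  · rcases l with _ | ⟨hl, ll, lx, lr⟩
    · simp at c1
    · rcases lr with _ | ⟨hm, m, y, m'⟩ <;> dsimp only <;> split_ifs <;>
        simp only [mk, Bal, height_node, height_nil] at * <;> grind
  · rcases r with _ | ⟨hr, rl, rx, rr⟩
    · simp at c2
    · rcases rl with _ | ⟨hm, m, y, m'⟩ <;> dsimp only <;> split_ifs <;>
        simp only [mk, Bal, height_node, height_nil] at * <;> grind
  · simp only [mk, Bal, height_node]
    exact ⟨⟨hl, hr, trivial, by omega, by omega⟩, by omega, by omega, fun _ _ => trivial⟩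

theorem insert_bal (cmp : α → Timed Ordering) (new : α) (upd : α → α) {t : AVL α} (ht : t.Bal) :
    (t.insert cmp new upd).val.Bal ∧ t.height ≤ (t.insert cmp new upd).val.height ∧
      (t.insert cmp new upd).val.height ≤ t.height + 1 := by
  induction t with
  | nil => simp [insert, mk, Bal]
  | node h l x r ihl ihr =>
    obtain ⟨hl, hr, hh, h1, h2⟩ := ht
    obtain ⟨l1, l2, l3⟩ := ihl hl
    obtain ⟨r1, r2, r3⟩ := ihr hr
    rw [insert]
    simp only [Timed.bind_val]
    cases (cmp x).val
    · have hb := balance_spec x l1 hr (by omega) (by omega)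
      simp only [Timed.bind_val, step_val, height_node]
      refine ⟨hb.1, ?_, ?_⟩ <;> omega
    · simp only [step_val, height_node]
      exact ⟨⟨hl, hr, hh, h1, h2⟩, le_rfl, by omega⟩
    · have hb := balance_spec x hl r1 (by omega) (by omega)
      simp only [Timed.bind_val, step_val, height_node]
      refine ⟨hb.1, ?_, ?_⟩ <;> omega

theorem insert_time_le (c : α → Ordering) (new : α) (upd : α → α) {t : AVL α} (ht : t.Bal) :
    (t.insert (fun x => step (c x)) new upd).time ≤ 2 * t.height + 1 := by
  induction t with
  | nil => simp [insert]
  | node h l x r ihl ihr =>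
    obtain ⟨hl, hr, hh, h1, h2⟩ := ht
    have il := ihl hl
    have ir := ihr hr
    rw [insert]
    simp only [Timed.bind_time, step_val, step_time, height_node]
    cases c x <;> simp only [Timed.bind_time, step_time] <;> omega

/-- An insertion either updates one entry at the searched position, or, if there is none, puts the
new entry at this position. -/
theorem insert_toList (c : α → Ordering) (new : α) (upd : α → α) {t : AVL α}
    (ht : Directed c t.toList) :
    (∃ l₁ x l₂, t.toList = l₁ ++ x :: l₂ ∧ c x = .eq ∧
      (t.insert (fun x => step (c x)) new upd).val.toList = l₁ ++ upd x :: l₂) ∨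
    (∃ l₁ l₂, t.toList = l₁ ++ l₂ ∧ (∀ x ∈ l₁, c x = .gt) ∧ (∀ x ∈ l₂, c x = .lt) ∧
      (t.insert (fun x => step (c x)) new upd).val.toList = l₁ ++ new :: l₂) := by
  induction t with
  | nil => exact Or.inr ⟨[], [], by simp [insert, mk]⟩
  | node h l x r ihl ihr =>
    obtain ⟨hl, hxr, hlr⟩ := List.pairwise_append.1 ht
    obtain ⟨hx, hr⟩ := List.pairwise_cons.1 hxr
    rw [insert]
    simp only [Timed.bind_val, step_val]
    cases hc : c x
    · simp only [Timed.bind_val, step_val, toList_balance, toList_node]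
      rcases ihl hl with ⟨l₁, y, l₂, e1, e2, e3⟩ | ⟨l₁, l₂, e1, e2, e3, e4⟩
      · exact Or.inl ⟨l₁, y, l₂ ++ x :: r.toList, by simp [e1], e2, by simp [e3]⟩
      · refine Or.inr ⟨l₁, l₂ ++ x :: r.toList, by simp [e1], e2, ?_, by simp [e4]⟩
        intro y hy
        rcases List.mem_append.1 hy with hy | hy
        · exact e3 y hy
        · rcases List.mem_cons.1 hy with rfl | hy
          · exact hc
          · exact (hx y hy).2 hc
    · exact Or.inl ⟨l.toList, x, r.toList, rfl, hc, rfl⟩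
    · simp only [Timed.bind_val, step_val, toList_balance, toList_node]
      rcases ihr hr with ⟨l₁, y, l₂, e1, e2, e3⟩ | ⟨l₁, l₂, e1, e2, e3, e4⟩
      · exact Or.inl ⟨l.toList ++ x :: l₁, y, l₂, by simp [e1], e2, by simp [e3]⟩
      · refine Or.inr ⟨l.toList ++ x :: l₁, l₂, by simp [e1], ?_, e3, by simp [e4]⟩
        intro y hy
        rcases List.mem_append.1 hy with hy | hy
        · exact (hlr y hy x List.mem_cons_self).1 hc
        · rcases List.mem_cons.1 hy with rfl | hy
          · exact hc
          · exact e2 y hy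

theorem popMin_bal {t : AVL α} (ht : t.Bal) {y : α} {t' : AVL α}
    (h : t.popMin.val = some (y, t')) :
    t'.Bal ∧ t'.height ≤ t.height ∧ t.height ≤ t'.height + 1 := by
  induction t generalizing y t' with
  | nil => simp [popMin] at h
  | node hh l x r ihl ihr =>
    obtain ⟨hl, hr, e, h1, h2⟩ := ht
    rw [popMin] at h
    simp only [Timed.bind_val] at h
    rcases hp : l.popMin.val with _ | ⟨z, l'⟩
    · have hln : l = nil := by
        cases l with
        | nil => rfl
        | node hh' a b c =>
          rw [popMin] at hp
          simp only [Timed.bind_val] at hp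
          rcases hq : a.popMin.val with _ | ⟨z, l'⟩ <;> simp [hq] at hp
      simp only [hp, step_val, Option.some.injEq, Prod.mk.injEq] at h
      obtain ⟨rfl, rfl⟩ := h
      subst hln
      simp only [height_nil, height_node] at *
      exact ⟨hr, by omega, by omega⟩
    · simp only [hp, step_val, Option.some.injEq, Prod.mk.injEq] at h
      obtain ⟨rfl, rfl⟩ := h
      obtain ⟨b1, b2, b3⟩ := ihl hl hp
      have hb := balance_spec x b1 hr (by omega) (by omega)
      simp only [height_node]
      refine ⟨hb.1, ?_, ?_⟩ <;> omega

theorem popMin_time_le {t : AVL α} (ht : t.Bal) : t.popMin.time ≤ t.height + 1 := by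
  induction t with
  | nil => simp [popMin]
  | node hh l x r ihl ihr =>
    obtain ⟨hl, hr, e, h1, h2⟩ := ht
    have := ihl hl
    rw [popMin]
    simp only [Timed.bind_time, height_node]
    rcases l.popMin.val with _ | ⟨z, l'⟩ <;> simp only [step_time] <;> omega

theorem popMin_toList (t : AVL α) :
    (t.popMin.val = none ∧ t.toList = []) ∨
      ∃ y t', t.popMin.val = some (y, t') ∧ t.toList = y :: t'.toList := by
  induction t with
  | nil => simp [popMin]
  | node hh l x r ihl ihr =>
    right
    rw [popMin]
    simp only [Timed.bind_val]
    rcases ihl with ⟨h1, h2⟩ | ⟨y, l', h1, h2⟩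
    · exact ⟨x, r, by simp [h1], by simp [h2]⟩
    · exact ⟨y, balance l' x r, by simp [h1], by simp [h2, toList_balance]⟩

theorem remove_bal (cmp : α → Timed Ordering) {t : AVL α} (ht : t.Bal) {y : α} {t' : AVL α}
    (h : (t.remove cmp).val = some (y, t')) :
    t'.Bal ∧ t'.height ≤ t.height ∧ t.height ≤ t'.height + 1 := by
  induction t generalizing y t' with
  | nil => simp [remove] at h
  | node hh l x r ihl ihr =>
    obtain ⟨hl, hr, e, h1, h2⟩ := ht
    rw [remove] at h
    simp only [Timed.bind_val] at h
    simp only [height_node]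
    cases hc : (cmp x).val <;> simp only [hc, Timed.bind_val] at h
    · rcases hp : (l.remove cmp).val with _ | ⟨z, l'⟩ <;>
        simp only [hp, step_val, Option.some.injEq, Prod.mk.injEq, reduceCtorEq] at h
      obtain ⟨rfl, rfl⟩ := h
      obtain ⟨b1, b2, b3⟩ := ihl hl hp
      have hb := balance_spec x b1 hr (by omega) (by omega)
      refine ⟨hb.1, ?_, ?_⟩ <;> omega
    · rcases popMin_toList r with ⟨hp, hq⟩ | ⟨z, r', hp, hq⟩ <;>
        simp only [hp, step_val, Option.some.injEq, Prod.mk.injEq] at h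
      · obtain ⟨rfl, rfl⟩ := h
        have hrn : r = nil := by
          cases r with
          | nil => rfl
          | node => simp at hq
        subst hrn
        simp only [height_nil] at *
        exact ⟨hl, by omega, by omega⟩
      · obtain ⟨rfl, rfl⟩ := h
        obtain ⟨b1, b2, b3⟩ := popMin_bal hr hp
        have hb := balance_spec z hl b1 (by omega) (by omega)
        refine ⟨hb.1, ?_, ?_⟩ <;> omega
    · rcases hp : (r.remove cmp).val with _ | ⟨z, r'⟩ <;>
        simp only [hp, step_val, Option.some.injEq, Prod.mk.injEq, reduceCtorEq] at h
      obtain ⟨rfl, rfl⟩ := h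
      obtain ⟨b1, b2, b3⟩ := ihr hr hp
      have hb := balance_spec x hl b1 (by omega) (by omega)
      refine ⟨hb.1, ?_, ?_⟩ <;> omega

theorem remove_time_le (c : α → Ordering) {t : AVL α} (ht : t.Bal) :
    (t.remove (fun x => step (c x))).time ≤ 2 * t.height + 1 := by
  induction t with
  | nil => simp [remove]
  | node hh l x r ihl ihr =>
    obtain ⟨hl, hr, e, h1, h2⟩ := ht
    have il := ihl hl
    have ir := ihr hr
    have ip := popMin_time_le hr
    rw [remove]
    simp only [Timed.bind_time, height_node, step_val, step_time]
    cases c x <;> simp only [Timed.bind_time]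
    · rcases (l.remove fun x => step (c x)).val with _ | ⟨z, l'⟩ <;>
        simp only [step_time] <;> omega
    · rcases r.popMin.val with _ | ⟨z, l'⟩ <;> simp only [step_time] <;> omega
    · rcases (r.remove fun x => step (c x)).val with _ | ⟨z, l'⟩ <;>
        simp only [step_time] <;> omega

theorem remove_toList (c : α → Ordering) {t : AVL α} (ht : Directed c t.toList) :
    ((t.remove (fun x => step (c x))).val = none ∧ ∀ x ∈ t.toList, c x ≠ .eq) ∨
      ∃ y t' l₁ l₂, (t.remove (fun x => step (c x))).val = some (y, t') ∧ c y = .eq ∧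
        t.toList = l₁ ++ y :: l₂ ∧ t'.toList = l₁ ++ l₂ := by
  induction t with
  | nil => simp [remove]
  | node hh l x r ihl ihr =>
    obtain ⟨hl, hxr, hlr⟩ := List.pairwise_append.1 ht
    obtain ⟨hx, hr⟩ := List.pairwise_cons.1 hxr
    rw [remove]
    simp only [Timed.bind_val, step_val]
    cases hc : c x <;> simp only [Timed.bind_val]
    · rcases ihl hl with ⟨h1, h2⟩ | ⟨y, t', l₁, l₂, h1, h2, h3, h4⟩
      · left
        simp only [h1, step_val, toList_node, true_and]
        intro y hy
        rcases List.mem_append.1 hy with hy | hy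
        · exact h2 y hy
        · rcases List.mem_cons.1 hy with rfl | hy
          · simp [hc]
          · simp [(hx y hy).2 hc]
      · exact Or.inr ⟨y, balance t' x r, l₁, l₂ ++ x :: r.toList, by simp [h1], h2,
          by simp [h3], by simp [toList_balance, h4]⟩
    · right
      rcases popMin_toList r with ⟨hp, hq⟩ | ⟨z, r', hp, hq⟩
      · exact ⟨x, l, l.toList, [], by simp [hp], hc, by simp [hq], by simp⟩
      · exact ⟨x, balance l z r', l.toList, r.toList, by simp [hp], hc, by simp,
          by simp [toList_balance, hq]⟩
    · rcases ihr hr with ⟨h1, h2⟩ | ⟨y, t', l₁, l₂, h1, h2, h3, h4⟩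
      · left
        simp only [h1, step_val, toList_node, true_and]
        intro y hy
        rcases List.mem_append.1 hy with hy | hy
        · simp [(hlr y hy x List.mem_cons_self).1 hc]
        · rcases List.mem_cons.1 hy with rfl | hy
          · simp [hc]
          · exact h2 y hy
      · exact Or.inr ⟨y, balance l x t', l.toList ++ x :: l₁, l₂, by simp [h1], h2,
          by simp [h3], by simp [toList_balance, h4]⟩

theorem findBefore_val (c : α → Ordering) (best : Option α) {t : AVL α}
    (ht : Directed c t.toList) :
    (t.findBefore (fun x => step (c x)) best).val =
      (t.toList.filter (fun x => c x = .gt)).getLast?.or best := by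
  induction t generalizing best with
  | nil => simp [findBefore]
  | node hh l x r ihl ihr =>
    obtain ⟨hl, hxr, hlr⟩ := List.pairwise_append.1 ht
    obtain ⟨hx, hr⟩ := List.pairwise_cons.1 hxr
    have hnil : c x ≠ .gt → r.toList.filter (fun y => c y = .gt) = [] := by
      intro h
      simp only [List.filter_eq_nil_iff, decide_eq_true_eq]
      exact fun y hy hg => h ((hx y hy).1 hg)
    rw [findBefore]
    simp only [Timed.bind_val, step_val]
    cases hc : c x <;> dsimp only
    · rw [ihl _ hl]
      simp [hc, hnil (by simp [hc])]
    · rw [ihl _ hl]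
      simp [hc, hnil (by simp [hc])]
    · rw [ihr _ hr]
      simp only [toList_node, List.filter_append, hc, decide_true, List.filter_cons_of_pos,
        List.getLast?_append, List.getLast?_cons]
      cases (List.filter (fun x => decide (c x = .gt)) r.toList).getLast? <;> simp

theorem findBefore_time_le (c : α → Ordering) (best : Option α) {t : AVL α} (ht : t.Bal) :
    (t.findBefore (fun x => step (c x)) best).time ≤ t.height + 1 := by
  induction t generalizing best with
  | nil => simp [findBefore]
  | node hh l x r ihl ihr =>
    obtain ⟨hl, hr, e, h1, h2⟩ := ht
    rw [findBefore]
    simp only [Timed.bind_time, height_node, step_val, step_time]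
    have i1 := ihl best hl
    have i2 := ihr (some x) hr
    cases c x <;> dsimp only <;> omega

theorem findAfter_val (c : α → Ordering) (best : Option α) {t : AVL α}
    (ht : Directed c t.toList) :
    (t.findAfter (fun x => step (c x)) best).val =
      (t.toList.filter (fun x => c x = .lt)).head?.or best := by
  induction t generalizing best with
  | nil => simp [findAfter]
  | node hh l x r ihl ihr =>
    obtain ⟨hl, hxr, hlr⟩ := List.pairwise_append.1 ht
    obtain ⟨hx, hr⟩ := List.pairwise_cons.1 hxr
    have hnil : c x ≠ .lt → l.toList.filter (fun y => c y = .lt) = [] := by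
      intro h
      simp only [List.filter_eq_nil_iff, decide_eq_true_eq]
      exact fun y hy hg => h ((hlr y hy x List.mem_cons_self).2 hg)
    rw [findAfter]
    simp only [Timed.bind_val, step_val]
    cases hc : c x <;> dsimp only
    · rw [ihl _ hl]
      simp only [toList_node, List.filter_append, hc, decide_true, List.filter_cons_of_pos,
        List.head?_append, List.head?_cons]
      cases (List.filter (fun x => decide (c x = .lt)) l.toList).head? <;> simp
    · rw [ihr _ hr]
      simp [hc, hnil (by simp [hc])]
    · rw [ihr _ hr]
      simp [hc, hnil (by simp [hc])]

theorem findAfter_time_le (c : α → Ordering) (best : Option α) {t : AVL α} (ht : t.Bal) :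
    (t.findAfter (fun x => step (c x)) best).time ≤ t.height + 1 := by
  induction t generalizing best with
  | nil => simp [findAfter]
  | node hh l x r ihl ihr =>
    obtain ⟨hl, hr, e, h1, h2⟩ := ht
    rw [findAfter]
    simp only [Timed.bind_time, height_node, step_val, step_time]
    have i1 := ihl (some x) hl
    have i2 := ihr best hr
    cases c x <;> dsimp only <;> omega

theorem flatten_val (t : AVL α) (acc : List α) : (t.flatten acc).val = t.toList ++ acc := by
  induction t generalizing acc with
  | nil => simp [flatten]
  | node h l x r ihl ihr => simp [flatten, ihl, ihr]

theorem flatten_time (t : AVL α) (acc : List α) :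
    (t.flatten acc).time = t.toList.length + 1 := by
  induction t generalizing acc with
  | nil => simp [flatten]
  | node h l x r ihl ihr =>
    simp only [flatten, Timed.bind_time, ihl, ihr, toList_node, List.length_append,
      List.length_cons]
    omega

/-- Insertion of the entries `xs` into a tree with the entries `A ++ M ++ C`, if all of them belong
between `A` and `C`, and are compared with each other and with the entries of `M` according to the
strict order `R`. -/
theorem insertAll_spec (c : α → α → Ordering) (R : α → α → Prop) (hirr : ∀ x, ¬ R x x)
    (htrans : ∀ x y z, R x y → R y z → R x z) (A C : List α) (N : ℕ) (xs : List α) :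
    ∀ (M : List α) (t : AVL α), t.Bal → t.toList = A ++ M ++ C → M.Pairwise R →
      (xs ++ M).Nodup → (∀ x ∈ xs, ∀ y ∈ A, c x y = .gt) → (∀ x ∈ xs, ∀ y ∈ C, c x y = .lt) →
      (∀ x ∈ xs, ∀ y ∈ xs ++ M, x ≠ y → c x y = .gt ∧ R y x ∨ c x y = .lt ∧ R x y) →
      xs.length + t.toList.length ≤ N →
      ∃ M', (insertAll (fun x y => step (c x y)) xs t).val.toList = A ++ M' ++ C ∧
        (insertAll (fun x y => step (c x y)) xs t).val.Bal ∧ M'.Pairwise R ∧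
        M'.Perm (xs ++ M) ∧
        (insertAll (fun x y => step (c x y)) xs t).time ≤
          xs.length * (2 * heightBound N + 1) + 1 := by
  induction xs with
  | nil =>
    intro M t hb ht hM _ _ _ _ _
    exact ⟨M, by simpa [insertAll] using ht, by simpa [insertAll] using hb, hM, by simp,
      by simp [insertAll]⟩
  | cons x xs ih =>
    intro M t hb ht hM hnd hA hC hR hN
    simp only [insertAll, Timed.bind_val, Timed.bind_time]
    have hA' := hA x List.mem_cons_self
    have hC' := hC x List.mem_cons_self
    have hxM : ∀ y ∈ M, c x y = .gt ∧ R y x ∨ c x y = .lt ∧ R x y := fun y hy =>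
      hR x List.mem_cons_self y (by simp [hy]) (by
        rintro rfl
        simp [hy] at hnd)
    have hdir : Directed (c x) t.toList := by
      rw [ht]
      refine List.pairwise_append.2 ⟨List.pairwise_append.2 ⟨?_, ?_, ?_⟩, ?_, ?_⟩
      · exact List.pairwise_iff_forall_sublist.2 fun {a b} hab => by
          have ha := hA' a (hab.subset (by simp))
          simp [ha]
      · refine List.Pairwise.imp_of_mem ?_ hM
        intro a b ha hb hab
        rcases hxM a ha with ⟨h1, h2⟩ | ⟨h1, h2⟩ <;> rcases hxM b hb with ⟨h3, h4⟩ | ⟨h3, h4⟩ <;>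
          simp only [h1, h3, reduceCtorEq, implies_true, and_self, imp_self, imp_false,
            not_true_eq_false]
        exact hirr x (htrans _ _ _ h2 (htrans _ _ _ hab h4))
      · intro a ha b hb
        simp [hA' a ha]
      · exact List.pairwise_iff_forall_sublist.2 fun {a b} hab => by
          have hb := hC' b (hab.subset (by simp))
          simp [hb]
      · intro a ha b hb
        simp [hC' b hb]
    have hbal := insert_bal (fun y => step (c x y)) x id hb
    have htime := insert_time_le (c x) x id hb
    have hheight := hb.height_le (N := N) (by simp at hN; omega)
    rcases insert_toList (c x) x id hdir with ⟨l₁, y, l₂, h1, h2, -⟩ | ⟨l₁, l₂, h1, h2, h3, h4⟩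
    · exfalso
      have hy : y ∈ A ++ M ++ C := by rw [← ht, h1]; simp
      rcases List.mem_append.1 hy with hy | hy
      · rcases List.mem_append.1 hy with hy | hy
        · simp [hA' y hy] at h2
        · rcases hxM y hy with h | h <;> simp [h.1] at h2
      · simp [hC' y hy] at h2
    · -- the new entry is placed inside `M`
      obtain ⟨M₁, M₂, rfl, rfl, rfl⟩ : ∃ M₁ M₂, M = M₁ ++ M₂ ∧ l₁ = A ++ M₁ ∧ l₂ = M₂ ++ C := by
        have hf : ∀ (o o' : Ordering) (l : List α), (∀ y ∈ l, c x y = o) →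
            l.filter (fun y => c x y = o') = if o = o' then l else [] := by
          intro o o' l hl
          split_ifs with ho
          · exact List.filter_eq_self.2 fun y hy => by simp [hl y hy, ho]
          · exact List.filter_eq_nil_iff.2 fun y hy => by simp [hl y hy, ho]
        have h5 : l₁ ++ l₂ = A ++ M ++ C := h1.symm.trans ht
        have hMA : l₁ = A ++ M.filter (fun y => c x y = .gt) := by
          simpa [hf .gt .gt l₁ h2, hf .lt .gt l₂ h3, hf .gt .gt A hA', hf .lt .gt C hC']
            using congrArg (List.filter fun y => decide (c x y = .gt)) h5
        have hMC : l₂ = M.filter (fun y => c x y = .lt) ++ C := by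
          simpa [hf .gt .lt l₁ h2, hf .lt .lt l₂ h3, hf .gt .lt A hA', hf .lt .lt C hC']
            using congrArg (List.filter fun y => decide (c x y = .lt)) h5
        refine ⟨_, _, ?_, hMA, hMC⟩
        have h5 : A ++ (M ++ C) = A ++ ((M.filter (fun y => c x y = .gt) ++
            M.filter (fun y => c x y = .lt)) ++ C) := by
          rw [← List.append_assoc, ← ht, h1, hMA, hMC]
          simp
        exact List.append_cancel_right (List.append_cancel_left h5)
      obtain ⟨M', e1, e2, e3, e4, e5⟩ := ih (M₁ ++ x :: M₂)
        (t.insert (fun y => step (c x y)) x id).val hbal.1 (by simp [h4]) (by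
          obtain ⟨p1, p2, p3⟩ := List.pairwise_append.1 hM
          refine List.pairwise_append.2 ⟨p1, List.pairwise_cons.2 ⟨?_, p2⟩, ?_⟩
          · intro y hy
            rcases hxM y (by simp [hy]) with h | h
            · simp [h3 y (by simp [hy])] at h
            · exact h.2
          · intro a ha b hb
            rcases List.mem_cons.1 hb with rfl | hb
            · rcases hxM a (by simp [ha]) with h | h
              · exact h.2
              · simp [h2 a (by simp [ha])] at h
            · exact p3 a ha b hb)
        ((List.Perm.nodup_iff (by
            have : (M₁ ++ x :: M₂).Perm (x :: (M₁ ++ M₂)) := List.perm_middle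
            exact ((this.append_left xs).trans List.perm_middle))).2 hnd)
        (fun z hz => hA z (by simp [hz])) (fun z hz => hC z (by simp [hz]))
        (fun z hz y hy => hR z (by simp [hz]) y (by
          simp only [List.mem_append, List.mem_cons] at hy ⊢
          tauto))
        (by
          rw [h4]
          rw [h1] at hN
          simp at hN ⊢
          omega)
      refine ⟨M', e1, e2, e3, e4.trans ?_, ?_⟩
      · have : (M₁ ++ x :: M₂).Perm (x :: (M₁ ++ M₂)) := List.perm_middle
        exact ((this.append_left xs).trans List.perm_middle)
      · simp only [List.length_cons, Nat.add_mul]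
        omega

end AVL

/-- Sorting puts a list into increasing order, within `O(m log m)` steps. -/
theorem sort_spec {α : Type} (c : α → α → Ordering) (R : α → α → Prop) (hirr : ∀ x, ¬ R x x)
    (htrans : ∀ x y z, R x y → R y z → R x z) (xs : List α) (hnd : xs.Nodup)
    (hc : ∀ x ∈ xs, ∀ y ∈ xs, x ≠ y → c x y = .gt ∧ R y x ∨ c x y = .lt ∧ R x y)
    {N : ℕ} (hN : xs.length ≤ N) :
    (sort (fun x y => step (c x y)) xs).val.Pairwise R ∧
      (sort (fun x y => step (c x y)) xs).val.Perm xs ∧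
      (sort (fun x y => step (c x y)) xs).time ≤
        xs.length * (2 * AVL.heightBound N + 2) + 2 := by
  obtain ⟨M, e1, e2, e3, e4, e5⟩ := AVL.insertAll_spec c R hirr htrans [] [] N xs [] AVL.nil
    trivial rfl List.Pairwise.nil (by simpa using hnd) (by simp) (by simp) (by simpa using hc)
    (by simpa using hN)
  simp only [List.nil_append, List.append_nil] at e1 e4
  refine ⟨?_, ?_, ?_⟩
  · simpa [sort, AVL.flatten_val, e1] using e3
  · simpa [sort, AVL.flatten_val, e1] using e4
  · simp only [sort, Timed.bind_time, AVL.flatten_time, e1, e4.length_eq]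
    have : xs.length * (2 * AVL.heightBound N + 2) =
      xs.length * (2 * AVL.heightBound N + 1) + xs.length := by ring
    omega

/-! ### The lexicographic order and the orientation of vectors -/

/-- A vector that points forward in the lexicographic order, the direction of the sweep. -/
def LexPos (w : ℝ × ℝ) : Prop := 0 < w.1 ∨ w.1 = 0 ∧ 0 < w.2

theorem toLex_lt_iff {u v : ℝ × ℝ} : toLex u < toLex v ↔ LexPos (v - u) := by
  rw [Prod.Lex.toLex_lt_toLex, LexPos, Prod.fst_sub, Prod.snd_sub, sub_pos, sub_pos, sub_eq_zero,
    eq_comm]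

theorem LexPos.add {u v : ℝ × ℝ} (hu : LexPos u) (hv : LexPos v) : LexPos (u + v) := by
  unfold LexPos at *
  rw [Prod.fst_add, Prod.snd_add]
  rcases hu with hu | ⟨hu, hu'⟩ <;> rcases hv with hv | ⟨hv, hv'⟩
  · exact Or.inl (by linarith)
  · exact Or.inl (by linarith)
  · exact Or.inl (by linarith)
  · exact Or.inr ⟨by linarith, by linarith⟩

theorem LexPos.smul {u : ℝ × ℝ} (hu : LexPos u) {t : ℝ} (ht : 0 < t) : LexPos (t • u) := by
  unfold LexPos at *
  rw [Prod.smul_fst, Prod.smul_snd, smul_eq_mul, smul_eq_mul]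
  rcases hu with hu | ⟨hu, hu'⟩
  · exact Or.inl (by positivity)
  · exact Or.inr ⟨by simp [hu], by positivity⟩

theorem not_lexPos_zero : ¬ LexPos 0 := by simp [LexPos]

theorem LexPos.not_neg {u : ℝ × ℝ} (hu : LexPos u) : ¬ LexPos (-u) := fun h =>
  not_lexPos_zero (by simpa using hu.add h)

theorem LexPos.smul_iff {u : ℝ × ℝ} (hu : LexPos u) {t : ℝ} : LexPos (t • u) ↔ 0 < t := by
  refine ⟨fun h => ?_, hu.smul⟩
  by_contra! ht
  rcases ht.eq_or_lt with rfl | ht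
  · simp [not_lexPos_zero] at h
  · exact h.not_neg (by simpa using hu.smul (neg_pos.2 ht))

theorem LexPos.ne_zero {u : ℝ × ℝ} (hu : LexPos u) : u ≠ 0 := by
  rintro rfl
  exact not_lexPos_zero hu

theorem exists_smul_of_cross_eq_zero {d w : ℝ × ℝ} (hd : d ≠ 0) (h : cross d w = 0) :
    ∃ t : ℝ, w = t • d := by
  unfold cross at h
  by_cases h1 : d.1 = 0
  · have h2 : d.2 ≠ 0 := fun h2 => hd (Prod.ext h1 h2)
    refine ⟨w.2 / d.2, Prod.ext ?_ ?_⟩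
    · have : w.1 = 0 := by simpa [h1, h2] using h
      simp [this, h1]
    · simp [h2]
  · refine ⟨w.1 / d.1, Prod.ext ?_ ?_⟩
    · simp [h1]
    · simp only [Prod.smul_snd, smul_eq_mul]
      field_simp
      linarith

theorem cross_smul_self (d : ℝ × ℝ) (t : ℝ) : cross d (t • d) = 0 := by
  simp only [cross, Prod.smul_fst, Prod.smul_snd, smul_eq_mul]
  ring

theorem cross_add_right (d u v : ℝ × ℝ) : cross d (u + v) = cross d u + cross d v := by
  simp only [cross, Prod.fst_add, Prod.snd_add]
  ring

theorem cross_sub_right (d u v : ℝ × ℝ) : cross d (u - v) = cross d u - cross d v := by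
  simp only [cross, Prod.fst_sub, Prod.snd_sub]
  ring

theorem cross_smul_right (d u : ℝ × ℝ) (t : ℝ) : cross d (t • u) = t * cross d u := by
  simp only [cross, Prod.smul_fst, Prod.smul_snd, smul_eq_mul]
  ring

theorem cross_smul_left (d u : ℝ × ℝ) (t : ℝ) : cross (t • d) u = t * cross d u := by
  simp only [cross, Prod.smul_fst, Prod.smul_snd, smul_eq_mul]
  ring

theorem cross_anticomm (d e : ℝ × ℝ) : cross d e = -cross e d := by
  simp only [cross]
  ring

theorem cross_self (d : ℝ × ℝ) : cross d d = 0 := by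
  simp only [cross]
  ring

/-- Cramer's rule in the plane. -/
theorem cross_smul_eq (d e u : ℝ × ℝ) : cross e d • u = cross e u • d - cross d u • e := by
  ext <;> simp only [cross, Prod.smul_fst, Prod.smul_snd, smul_eq_mul, Prod.fst_sub,
    Prod.snd_sub] <;> ring

/-- A vector in the cone between two forward vectors is forward. -/
theorem lexPos_of_cross {d e u : ℝ × ℝ} (hd : LexPos d) (he : LexPos e) (hed : 0 < cross e d)
    (h1 : cross d u ≤ 0) (h2 : 0 ≤ cross e u) (h3 : cross d u < 0 ∨ 0 < cross e u) :
    LexPos u := by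
  have key : LexPos (cross e d • u) := by
    have e1 : cross e d • u = cross e u • d + (-cross d u) • e := by
      rw [cross_smul_eq]
      module
    rw [e1]
    rcases h1.eq_or_lt with h1 | h1 <;> rcases h2.eq_or_lt with h2 | h2
    · exfalso
      rcases h3 with h3 | h3 <;> linarith
    · simpa [h1] using hd.smul h2
    · simpa [← h2] using he.smul (neg_pos.2 h1)
    · exact (hd.smul h2).add (he.smul (neg_pos.2 h1))
  simpa [smul_smul, hed.ne'] using key.smul (inv_pos.2 hed)

theorem cross_pos_of_between {d e w : ℝ × ℝ} (hd : LexPos d) (he : LexPos e) (hw : LexPos w)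
    (h1 : cross d w ≤ 0) (h2 : 0 ≤ cross e w) (h3 : cross d w < 0 ∨ 0 < cross e w) :
    0 < cross e d := by
  rw [← hw.smul_iff]
  have e1 : cross e d • w = cross e w • d + (-cross d w) • e := by
    rw [cross_smul_eq]
    module
  rw [e1]
  rcases h1.eq_or_lt with h1 | h1 <;> rcases h2.eq_or_lt with h2 | h2
  · exfalso
    rcases h3 with h3 | h3 <;> linarith
  · simpa [h1] using hd.smul h2
  · simpa [← h2] using he.smul (neg_pos.2 h1)
  · exact (hd.smul h2).add (he.smul (neg_pos.2 h1))

/-- A forward vector that is not to the right of a forward vector `e` is to the left of any forward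
vector that `e` is to the left of. -/
theorem cross_pos_trans {d e w : ℝ × ℝ} (hd : LexPos d) (he : LexPos e) (hw : LexPos w)
    (h1 : 0 < cross d e) (h2 : 0 ≤ cross e w) : 0 < cross d w := by
  by_contra! h
  rcases h.eq_or_lt with h | h
  · obtain ⟨t, rfl⟩ := exists_smul_of_cross_eq_zero hd.ne_zero h
    have ht := hd.smul_iff.1 hw
    rw [cross_smul_right, cross_anticomm] at h2
    nlinarith
  · have := cross_pos_of_between hd he hw h.le h2 (Or.inl h)
    rw [cross_anticomm] at this
    linarith

theorem lexCmp_eq_lt {u v : ℝ × ℝ} : lexCmp u v = .lt ↔ toLex u < toLex v := by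
  rw [Prod.Lex.toLex_lt_toLex, lexCmp, Ordering.then_eq_lt, compare_lt_iff_lt, compare_lt_iff_lt,
    compare_eq_iff_eq]

theorem lexCmp_eq_gt {u v : ℝ × ℝ} : lexCmp u v = .gt ↔ toLex v < toLex u := by
  rw [Prod.Lex.toLex_lt_toLex, lexCmp, Ordering.then_eq_gt, compare_gt_iff_gt, compare_gt_iff_gt,
    compare_eq_iff_eq, @eq_comm _ u.1]

theorem lexCmp_eq_eq {u v : ℝ × ℝ} : lexCmp u v = .eq ↔ u = v := by
  rw [lexCmp, Ordering.then_eq_eq, compare_eq_iff_eq, compare_eq_iff_eq, Prod.ext_iff]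

/-! ### Points of segments -/

namespace Segment

variable {S T : Segment ℝ}

theorem lo_mem_ends (S : Segment ℝ) : S.lo = S.a ∨ S.lo = S.b := by
  unfold lo
  split_ifs <;> simp

theorem hi_mem_ends (S : Segment ℝ) : S.hi = S.a ∨ S.hi = S.b := by
  unfold hi
  split_ifs <;> simp

theorem ends_eq (S : Segment ℝ) : S.lo = S.a ∧ S.hi = S.b ∨ S.lo = S.b ∧ S.hi = S.a := by
  unfold lo hi
  split_ifs <;> simp

theorem lo_lt_hi (hS : S.a ≠ S.b) : toLex S.lo < toLex S.hi := by
  unfold lo hi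
  split_ifs with h
  · exact lexCmp_eq_gt.1 h
  · rw [lexCmp_eq_gt, not_lt] at h
    exact lt_of_le_of_ne h (by simpa using hS)

theorem dir_lexPos (hS : S.a ≠ S.b) : LexPos S.dir := toLex_lt_iff.1 (lo_lt_hi hS)

theorem points_eq (S : Segment ℝ) : S.points = segment ℝ S.lo S.hi := by
  unfold points
  rcases S.ends_eq with ⟨h1, h2⟩ | ⟨h1, h2⟩
  · rw [h1, h2]
  · rw [h1, h2, segment_symm]

theorem side_eq_lt {q : ℝ × ℝ} : S.side q = .lt ↔ cross S.dir (q - S.lo) < 0 :=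
  compare_lt_iff_lt

theorem side_eq_gt {q : ℝ × ℝ} : S.side q = .gt ↔ 0 < cross S.dir (q - S.lo) :=
  compare_gt_iff_gt

theorem side_eq_eq {q : ℝ × ℝ} : S.side q = .eq ↔ cross S.dir (q - S.lo) = 0 :=
  compare_eq_iff_eq

theorem mem_points_iff (hS : S.a ≠ S.b) {v : ℝ × ℝ} :
    v ∈ S.points ↔ S.side v = .eq ∧ toLex S.lo ≤ toLex v ∧ toLex v ≤ toLex S.hi := by
  have hd := dir_lexPos hS
  rw [points_eq, segment_eq_image', side_eq_eq]
  have key : ∀ t : ℝ, v - S.lo = t • S.dir →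
      (toLex S.lo ≤ toLex v ∧ toLex v ≤ toLex S.hi ↔ t ∈ Set.Icc (0 : ℝ) 1) := by
    intro t ht
    have h1 : S.lo - v = (-t) • S.dir := by rw [neg_smul, ← ht]; abel
    have h2 : v - S.hi = (t - 1) • S.dir := by rw [sub_smul, ← ht, one_smul, dir]; abel
    rw [← not_lt, ← not_lt, toLex_lt_iff, toLex_lt_iff, h1, h2, hd.smul_iff, hd.smul_iff,
      Set.mem_Icc]
    constructor <;> rintro ⟨h3, h4⟩ <;> constructor <;> linarith
  constructor
  · rintro ⟨t, ht, rfl⟩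
    have h : S.lo + t • (S.hi - S.lo) - S.lo = t • S.dir := by rw [dir]; abel
    refine ⟨?_, (key t h).2 ht⟩
    simp only [h, cross_smul_self]
  · rintro ⟨h, h'⟩
    obtain ⟨t, ht⟩ := exists_smul_of_cross_eq_zero hd.ne_zero h
    refine ⟨t, (key t ht).1 h', ?_⟩
    rw [dir] at ht
    simp only [← ht]
    abel

theorem lo_mem (S : Segment ℝ) : S.lo ∈ S.points := by
  rw [points_eq]
  exact left_mem_segment ..

theorem hi_mem (S : Segment ℝ) : S.hi ∈ S.points := by
  rw [points_eq]
  exact right_mem_segment ..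

theorem cross_sub_eq_zero (hS : S.a ≠ S.b) {u v : ℝ × ℝ} (hu : u ∈ S.points)
    (hv : v ∈ S.points) : cross S.dir (v - u) = 0 := by
  have h1 := side_eq_eq.1 ((mem_points_iff hS).1 hu).1
  have h2 := side_eq_eq.1 ((mem_points_iff hS).1 hv).1
  rw [cross_sub_right] at *
  linarith

theorem cross_sub_of_mem (hS : S.a ≠ S.b) {u : ℝ × ℝ} (hu : u ∈ S.points) (r : ℝ × ℝ) :
    cross S.dir (r - S.lo) = cross S.dir (r - u) := by
  have h1 := side_eq_eq.1 ((mem_points_iff hS).1 hu).1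
  simp only [cross_sub_right] at *
  linarith

theorem cross_dir_eq_zero (hS : S.a ≠ S.b) (hT : T.a ≠ T.b) {u v : ℝ × ℝ} (huv : u ≠ v)
    (hu : u ∈ S.points) (hv : v ∈ S.points) (hu' : u ∈ T.points) (hv' : v ∈ T.points) :
    cross S.dir T.dir = 0 := by
  obtain ⟨t, ht⟩ := exists_smul_of_cross_eq_zero (dir_lexPos hS).ne_zero
    (cross_sub_eq_zero hS hu hv)
  have h := cross_sub_eq_zero hT hu' hv'
  rw [ht, cross_smul_right] at h
  have ht0 : t ≠ 0 := by
    rintro rfl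
    simp only [zero_smul, sub_eq_zero] at ht
    exact huv ht.symm
  rw [cross_anticomm]
  simpa [ht0] using h

theorem collinear_union (hS : S.a ≠ S.b) (hT : T.a ≠ T.b) {u : ℝ × ℝ} (hu : u ∈ S.points)
    (hu' : u ∈ T.points) (h : cross S.dir T.dir = 0) : Collinear ℝ (S.points ∪ T.points) := by
  rw [collinear_iff_of_mem (p₀ := u) (Or.inl hu)]
  refine ⟨S.dir, ?_⟩
  obtain ⟨c, hc⟩ := exists_smul_of_cross_eq_zero (dir_lexPos hS).ne_zero h
  rintro p (hp | hp)
  · obtain ⟨t, ht⟩ := exists_smul_of_cross_eq_zero (dir_lexPos hS).ne_zero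
      (cross_sub_eq_zero hS hu hp)
    exact ⟨t, by rw [← ht]; simp⟩
  · obtain ⟨t, ht⟩ := exists_smul_of_cross_eq_zero (dir_lexPos hT).ne_zero
      (cross_sub_eq_zero hT hu' hp)
    exact ⟨t * c, by rw [mul_smul, ← hc, ← ht]; simp⟩

/-- `S` is below `T` in the status after `q`: the order is kept as long as both segments last and
no common point has been swept. The order is expressed by the positions, relative to the two
segments, of the points `r` swept later: `r` is not above `T` unless it is above `S`, and not below
`S` unless it is below `T`. -/
def Below (q : ℝ × ℝ) (S T : Segment ℝ) : Prop :=
  ∀ r, toLex q < toLex r → toLex r ≤ toLex S.hi → toLex r ≤ toLex T.hi →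
    (∀ v ∈ S.points, v ∈ T.points → toLex q < toLex v → toLex v < toLex r → False) →
    (T.side r = .gt → S.side r = .gt) ∧ (S.side r = .lt → T.side r = .lt)

/-- The order persists while no common point is swept. -/
theorem Below.mono {q q' : ℝ × ℝ} (h : Below q S T) (hq : toLex q < toLex q')
    (hv : ∀ v ∈ S.points, v ∈ T.points → toLex q < toLex v → toLex v ≤ toLex q' → False) :
    Below q' S T := by
  intro r h1 h2 h3 h4
  refine h r (hq.trans h1) h2 h3 fun v hvS hvT hv1 hv2 => ?_
  rcases lt_or_ge (toLex q') (toLex v) with h5 | h5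
  · exact h4 v hvS hvT h5 hv2
  · exact hv v hvS hvT hv1 h5

/-- At `q`, the segment `S` is below `T`. A later point `r` on the wrong sides would be, just as
`q`, in a cone with its apex at a common point of the two segments, which is therefore swept
between `q` and `r`. -/
theorem below_of_sides (hS : S.a ≠ S.b) (hT : T.a ≠ T.b) {q : ℝ × ℝ}
    (hSq : toLex S.lo ≤ toLex q) (hTq : toLex T.lo ≤ toLex q)
    (h1 : 0 ≤ cross S.dir (q - S.lo)) (h2 : cross T.dir (q - T.lo) ≤ 0)
    (h3 : 0 < cross S.dir (q - S.lo) ∨ cross T.dir (q - T.lo) < 0) : Below q S T := by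
  intro r hqr hrS hrT hno
  by_contra hcon
  have hd := dir_lexPos hS
  have he := dir_lexPos hT
  rw [side_eq_gt, side_eq_gt, side_eq_lt, side_eq_lt] at hcon
  have h4 : cross S.dir (r - S.lo) ≤ 0 := by
    by_contra! h
    exact hcon ⟨fun _ => h, fun h' => absurd h' h.not_gt⟩
  have h5 : 0 ≤ cross T.dir (r - T.lo) := by
    by_contra! h
    exact hcon ⟨fun h' => absurd h' h.not_gt, fun _ => h⟩
  have h6 : cross S.dir (r - S.lo) < 0 ∨ 0 < cross T.dir (r - T.lo) := by
    by_contra! h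
    exact hcon ⟨fun h' => absurd h' h.2.not_gt, fun h' => absurd h' h.1.not_gt⟩
  have hw := toLex_lt_iff.1 hqr
  have hed : 0 < cross T.dir S.dir := by
    refine cross_pos_of_between hd he hw ?_ ?_ ?_
    · rw [cross_sub_right] at *; linarith
    · rw [cross_sub_right] at *; linarith
    · rcases h3 with h3 | h3
      · left; rw [cross_sub_right] at *; linarith
      · right; rw [cross_sub_right] at *; linarith
  -- the intersection point of the two lines
  obtain ⟨v, hvS, hvT⟩ : ∃ v : ℝ × ℝ, cross S.dir (v - S.lo) = 0 ∧ cross T.dir (v - T.lo) = 0 := by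
    refine ⟨S.lo + (cross T.dir (T.lo - S.lo) / cross T.dir S.dir) • S.dir, ?_, ?_⟩
    · rw [add_sub_cancel_left, cross_smul_self]
    · rw [add_sub_right_comm, cross_add_right, cross_smul_right, div_mul_cancel₀ _ hed.ne',
        ← cross_add_right]
      simp [cross]
  have hqv : toLex q < toLex v := by
    rw [toLex_lt_iff]
    refine lexPos_of_cross hd he hed ?_ ?_ ?_
    · rw [cross_sub_right] at *; linarith
    · rw [cross_sub_right] at *; linarith
    · rcases h3 with h3 | h3
      · left; rw [cross_sub_right] at *; linarith
      · right; rw [cross_sub_right] at *; linarith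
  have hvr : toLex v < toLex r := by
    rw [toLex_lt_iff]
    refine lexPos_of_cross hd he hed ?_ ?_ ?_
    · rw [cross_sub_right] at *; linarith
    · rw [cross_sub_right] at *; linarith
    · rcases h6 with h6 | h6
      · left; rw [cross_sub_right] at *; linarith
      · right; rw [cross_sub_right] at *; linarith
  exact hno v
    ((mem_points_iff hS).2 ⟨side_eq_eq.2 hvS, hSq.trans hqv.le, hvr.le.trans hrS⟩)
    ((mem_points_iff hT).2 ⟨side_eq_eq.2 hvT, hTq.trans hqv.le, hvr.le.trans hrT⟩) hqv hvr

/-- Two segments through `q` are ordered by their slopes after `q`. -/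
theorem below_of_slopes (hS : S.a ≠ S.b) (hT : T.a ≠ T.b) {q : ℝ × ℝ} (hSq : q ∈ S.points)
    (hTq : q ∈ T.points) (h : 0 < cross S.dir T.dir) : Below q S T := by
  intro r hqr _ _ _
  have hd := dir_lexPos hS
  have he := dir_lexPos hT
  have hw := toLex_lt_iff.1 hqr
  rw [side_eq_gt, side_eq_gt, side_eq_lt, side_eq_lt, cross_sub_of_mem hS hSq,
    cross_sub_of_mem hT hTq]
  refine ⟨fun h' => cross_pos_trans hd he hw h h'.le, fun h' => ?_⟩
  by_contra! h''
  exact h'.not_gt (cross_pos_trans hd he hw h h'')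

theorem meet_mem {v : ℝ × ℝ} (h : S.meet T = some v) :
    v ∈ S.points ∧ v ∈ T.points := by
  simp only [meet] at h
  split_ifs at h with hc
  obtain ⟨hden, hx0, hx1, hy0, hy1⟩ := hc
  simp only [Option.some.injEq] at h
  rw [points_eq, points_eq, segment_eq_image', segment_eq_image']
  refine ⟨⟨_, ⟨hx0, hx1⟩, h⟩, ⟨_, ⟨hy0, hy1⟩, ?_⟩⟩
  rw [← h]
  unfold cross dir at *
  simp only [Prod.fst_sub, Prod.snd_sub] at *
  ext
  · simp only [Prod.fst_add, Prod.smul_fst, Prod.fst_sub, smul_eq_mul]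
    field_simp
    ring
  · simp only [Prod.snd_add, Prod.smul_snd, Prod.snd_sub, smul_eq_mul]
    field_simp
    ring

theorem meet_eq_some (hden : cross S.dir T.dir ≠ 0) {v : ℝ × ℝ} (hvS : v ∈ S.points)
    (hvT : v ∈ T.points) : S.meet T = some v := by
  rw [points_eq, segment_eq_image'] at hvS hvT
  obtain ⟨x, hx, rfl⟩ := hvS
  obtain ⟨y, hy, hxy⟩ := hvT
  have hw : T.lo - S.lo = x • S.dir - y • T.dir := by
    simp only at hxy
    rw [dir, dir, sub_eq_sub_iff_add_eq_add, hxy]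
    abel
  have e1 : cross (T.lo - S.lo) T.dir / cross S.dir T.dir = x := by
    rw [div_eq_iff hden, hw]
    simp only [cross, Prod.fst_sub, Prod.snd_sub, Prod.smul_fst, Prod.smul_snd, smul_eq_mul]
    ring
  have e2 : cross (T.lo - S.lo) S.dir / cross S.dir T.dir = y := by
    rw [div_eq_iff hden, hw]
    simp only [cross, Prod.fst_sub, Prod.snd_sub, Prod.smul_fst, Prod.smul_snd, smul_eq_mul]
    ring
  simp only [meet, e1, e2]
  rw [if_pos ⟨hden, hx.1, hx.2, hy.1, hy.2⟩]
  rfl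

end Segment

/-! ### Vertices of admissible sets of segments -/

section Admissible

variable {n : ℕ} {s : Fin n → Segment ℝ}

theorem lo_mem_vertices (s : Fin n → Segment ℝ) (k : Fin n) : (s k).lo ∈ vertices s :=
  Or.inr ⟨k, (s k).lo_mem_ends⟩

theorem hi_mem_vertices (s : Fin n → Segment ℝ) (k : Fin n) : (s k).hi ∈ vertices s :=
  Or.inr ⟨k, (s k).hi_mem_ends⟩

theorem mem_vertices_of_mem {i j : Fin n} (hij : i ≠ j) {v : ℝ × ℝ} (hi : v ∈ (s i).points)
    (hj : v ∈ (s j).points) : v ∈ vertices s :=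
  Or.inl ⟨i, j, hij, hi, hj⟩

/-- A vertex is an end point of a segment or an inner point of two segments. -/
theorem vertex_cases (hs : Admissible s) {v : ℝ × ℝ} (hv : v ∈ vertices s) :
    (∃ k, v = (s k).lo ∨ v = (s k).hi) ∨
      ∃ i j, i ≠ j ∧ v ∈ (s i).points ∧ v ∈ (s j).points ∧
        (toLex (s i).lo < toLex v ∧ toLex v < toLex (s i).hi) ∧
        (toLex (s j).lo < toLex v ∧ toLex v < toLex (s j).hi) := by
  rcases hv with ⟨i, j, hij, hi, hj⟩ | ⟨k, hk⟩
  · by_cases h : ∃ k, v = (s k).lo ∨ v = (s k).hi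
    · exact Or.inl h
    · right
      push Not at h
      have key : ∀ k, v ∈ (s k).points → toLex (s k).lo < toLex v ∧ toLex v < toLex (s k).hi := by
        intro k hk
        have h1 := ((s k).mem_points_iff (hs.nondegenerate k)).1 hk
        exact ⟨lt_of_le_of_ne h1.2.1 (by simpa using (h k).1.symm),
          lt_of_le_of_ne h1.2.2 (by simpa using (h k).2)⟩
      exact ⟨i, j, hij, hi, hj, key i hi, key j hj⟩
  · left
    rcases (s k).ends_eq with ⟨h1, h2⟩ | ⟨h1, h2⟩
    · exact ⟨k, by rw [h1, h2]; exact hk⟩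
    · exact ⟨k, by rw [h1, h2]; exact hk.symm⟩

theorem Admissible.eq_of_mem (hs : Admissible s) {i j : Fin n} (hij : i ≠ j) {u v : ℝ × ℝ}
    (hui : u ∈ (s i).points) (huj : u ∈ (s j).points) (hvi : v ∈ (s i).points)
    (hvj : v ∈ (s j).points) : u = v := by
  by_contra huv
  have h := Segment.cross_dir_eq_zero (hs.nondegenerate i) (hs.nondegenerate j) huv hui hvi huj hvj
  exact huv (hs.collinear i j hij (Segment.collinear_union (hs.nondegenerate i)
    (hs.nondegenerate j) hui huj h) ⟨hui, huj⟩ ⟨hvi, hvj⟩)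

/-- If two parallel segments have a common point, then a point of one of them between the ends of
the other, in the lexicographic order, belongs to both, and hence is that common point. -/
theorem Admissible.eq_of_parallel (hs : Admissible s) {i j : Fin n} (hij : i ≠ j) {u v : ℝ × ℝ}
    (hui : u ∈ (s i).points) (huj : u ∈ (s j).points)
    (h : cross (s i).dir (s j).dir = 0) (hvi : v ∈ (s i).points)
    (h1 : toLex (s j).lo ≤ toLex v) (h2 : toLex v ≤ toLex (s j).hi) : u = v := by
  refine hs.eq_of_mem hij hui huj hvi
    (((s j).mem_points_iff (hs.nondegenerate j)).2 ⟨?_, h1, h2⟩)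
  rw [Segment.side_eq_eq, Segment.cross_sub_of_mem (hs.nondegenerate j) huj]
  obtain ⟨c, hc⟩ := exists_smul_of_cross_eq_zero
    (Segment.dir_lexPos (hs.nondegenerate i)).ne_zero h
  rw [hc, cross_smul_left, Segment.cross_sub_eq_zero (hs.nondegenerate i) hui hvi, mul_zero]

theorem Admissible.cross_ne_zero_of_lt_hi (hs : Admissible s) {i j : Fin n} (hij : i ≠ j)
    {u : ℝ × ℝ} (hui : u ∈ (s i).points) (huj : u ∈ (s j).points)
    (hi : toLex u < toLex (s i).hi) (hj : toLex u < toLex (s j).hi) :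
    cross (s i).dir (s j).dir ≠ 0 := by
  intro h
  have hi' := ((s i).mem_points_iff (hs.nondegenerate i)).1 hui
  have hj' := ((s j).mem_points_iff (hs.nondegenerate j)).1 huj
  rcases le_total (toLex (s i).hi) (toLex (s j).hi) with hle | hle
  · have := hs.eq_of_parallel hij hui huj h (s i).hi_mem (hj'.2.1.trans hi.le) hle
    exact hi.ne (congrArg toLex this)
  · have := hs.eq_of_parallel hij.symm huj hui (by rw [cross_anticomm, h, neg_zero]) (s j).hi_mem
      (hi'.2.1.trans hj.le) hle
    exact hj.ne (congrArg toLex this)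

theorem Admissible.cross_ne_zero_of_lo_lt (hs : Admissible s) {i j : Fin n} (hij : i ≠ j)
    {u : ℝ × ℝ} (hui : u ∈ (s i).points) (huj : u ∈ (s j).points)
    (hi : toLex (s i).lo < toLex u) (hj : toLex (s j).lo < toLex u) :
    cross (s i).dir (s j).dir ≠ 0 := by
  intro h
  have hi' := ((s i).mem_points_iff (hs.nondegenerate i)).1 hui
  have hj' := ((s j).mem_points_iff (hs.nondegenerate j)).1 huj
  rcases le_total (toLex (s i).lo) (toLex (s j).lo) with hle | hle
  · have := hs.eq_of_parallel hij.symm huj hui (by rw [cross_anticomm, h, neg_zero]) (s j).lo_mem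
      hle (hj.le.trans hi'.2.2)
    exact hj.ne' (congrArg toLex this)
  · have := hs.eq_of_parallel hij hui huj h (s i).lo_mem hle (hi.le.trans hj'.2.2)
    exact hi.ne' (congrArg toLex this)

/-- There are at most `n ^ 2 + 2 n` vertices, as two segments have at most one common point. -/
theorem Admissible.vertices_finite (hs : Admissible s) :
    (vertices s).Finite ∧ (vertices s).ncard ≤ n * n + 2 * n := by
  classical
  let f : (Fin n × Fin n) ⊕ (Fin n ⊕ Fin n) → ℝ × ℝ := Sum.elim
    (fun ij => if h : ∃ v, v ∈ (s ij.1).points ∧ v ∈ (s ij.2).points then h.choose else 0)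
    (Sum.elim (fun k => (s k).a) (fun k => (s k).b))
  have hsub : vertices s ⊆ Set.range f := by
    rintro v (⟨i, j, hij, hi, hj⟩ | ⟨k, rfl | rfl⟩)
    · refine ⟨Sum.inl (i, j), ?_⟩
      have h : ∃ v, v ∈ (s i).points ∧ v ∈ (s j).points := ⟨v, hi, hj⟩
      have hf : f (Sum.inl (i, j)) = h.choose := by simp only [f, Sum.elim_inl, dif_pos h]
      rw [hf]
      exact hs.eq_of_mem hij h.choose_spec.1 h.choose_spec.2 hi hj
    · exact ⟨Sum.inr (Sum.inl k), rfl⟩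
    · exact ⟨Sum.inr (Sum.inr k), rfl⟩
  refine ⟨(Set.finite_range f).subset hsub, ?_⟩
  calc (vertices s).ncard ≤ (Set.range f).ncard := Set.ncard_le_ncard hsub (Set.finite_range f)
    _ ≤ Nat.card ((Fin n × Fin n) ⊕ (Fin n ⊕ Fin n)) := by
      rw [← Nat.card_coe_set_eq]
      exact Finite.card_range_le f
    _ = n * n + 2 * n := by simp; ring

end Admissible

open AVL Segment

variable {n : ℕ} {s : Fin n → Segment ℝ}

/-! ### The event queue -/

/-- The points in an event queue. -/
def keys (Q : AVL ((ℝ × ℝ) × List (Fin n))) : List (ℝ × ℝ) := Q.toList.map Prod.fst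

/-- An event queue is sorted lexicographically. -/
def SortedQueue (Q : AVL ((ℝ × ℝ) × List (Fin n))) : Prop :=
  Q.toList.Pairwise fun e f => toLex e.1 < toLex f.1

theorem SortedQueue.length_le (hfin : (vertices s).Finite)
    {Q : AVL ((ℝ × ℝ) × List (Fin n))} (hQ : SortedQueue Q) (hv : ∀ v ∈ keys Q, v ∈ vertices s) :
    Q.toList.length ≤ (vertices s).ncard := by
  have hnd : (keys Q).Nodup := by
    rw [keys, List.Nodup, List.pairwise_map]
    exact hQ.imp fun h h' => h.ne (congrArg toLex h')
  calc Q.toList.length = (keys Q).length := by simp [keys]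
    _ = (keys Q).toFinset.card := (List.toFinset_card_of_nodup hnd).symm
    _ = ((keys Q).toFinset : Set (ℝ × ℝ)).ncard := (Set.ncard_coe_finset _).symm
    _ ≤ (vertices s).ncard := Set.ncard_le_ncard (fun v h => hv v (by simpa using h)) hfin

theorem queue_insert_spec {Q : AVL ((ℝ × ℝ) × List (Fin n))} (hb : Q.Bal) (hQ : SortedQueue Q)
    (v : ℝ × ℝ) (l₀ : List (Fin n)) (upd : (ℝ × ℝ) × List (Fin n) → (ℝ × ℝ) × List (Fin n))
    (hupd : ∀ e, (upd e).1 = e.1) {Q' : Timed (AVL ((ℝ × ℝ) × List (Fin n)))}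
    (hQ' : Q' = Q.insert (fun e => step (lexCmp v e.1)) (v, l₀) upd) :
    Q'.val.Bal ∧ SortedQueue Q'.val ∧ (∀ x, x ∈ keys Q'.val ↔ x = v ∨ x ∈ keys Q) ∧
      (∀ e ∈ Q'.val.toList, (e ∈ Q.toList ∧ e.1 ≠ v) ∨ (∃ f ∈ Q.toList, f.1 = v ∧ e = upd f) ∨
        (e = (v, l₀) ∧ v ∉ keys Q)) ∧ Q'.time ≤ 2 * Q.height + 1 := by
  have hdir : Directed (fun e => lexCmp v e.1) Q.toList := by
    refine List.Pairwise.imp ?_ hQ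
    intro e f hef
    simp only [lexCmp_eq_gt, lexCmp_eq_lt]
    exact ⟨hef.trans, fun h => h.trans hef⟩
  refine ⟨by rw [hQ']; exact (insert_bal _ _ _ hb).1, ?_, ?_, ?_, by
    rw [hQ']; exact insert_time_le _ _ _ hb⟩
  all_goals
    have H := insert_toList (fun e => lexCmp v e.1) (v, l₀) upd hdir
    rw [← hQ'] at H
    rcases H with ⟨l₁, x, l₂, h1, h2, h3⟩ | ⟨l₁, l₂, h1, h2, h3, h4⟩
  · have h := hQ
    simp only [SortedQueue, h1, h3, List.pairwise_append, List.pairwise_cons, List.mem_cons,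
      forall_eq_or_imp, hupd] at h ⊢
    exact h
  · have h := hQ
    simp only [lexCmp_eq_gt, lexCmp_eq_lt] at h2 h3
    simp only [SortedQueue, h1, h4, List.pairwise_append, List.pairwise_cons, List.mem_cons,
      forall_eq_or_imp] at h ⊢
    exact ⟨h.1, ⟨h3, h.2.1⟩, fun a ha => ⟨h2 a ha, h.2.2 a ha⟩⟩
  · intro x'
    rw [lexCmp_eq_eq] at h2
    simp only [keys, h1, h3, List.map_append, List.map_cons, hupd, List.mem_append, List.mem_cons,
      h2]
    tauto
  · intro x'
    simp only [keys, h1, h4, List.map_append, List.map_cons, List.mem_append, List.mem_cons]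
    tauto
  · rw [lexCmp_eq_eq] at h2
    intro e he
    have h := hQ
    simp only [SortedQueue, h1, List.pairwise_append, List.pairwise_cons, List.mem_cons,
      forall_eq_or_imp] at h
    simp only [h3, List.mem_append, List.mem_cons] at he
    simp only [h1, List.mem_append, List.mem_cons]
    rcases he with he | rfl | he
    · left
      exact ⟨Or.inl he, fun h' => (h.2.2 e he).1.ne (by rw [h', h2])⟩
    · right; left
      exact ⟨x, by simp, h2.symm, rfl⟩
    · left
      exact ⟨Or.inr (Or.inr he), fun h' => (h.2.1.1 e he).ne' (by rw [h', h2])⟩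
  · intro e he
    simp only [lexCmp_eq_gt, lexCmp_eq_lt] at h2 h3
    simp only [h4, List.mem_append, List.mem_cons] at he
    simp only [h1, List.mem_append]
    rcases he with he | rfl | he
    · left
      exact ⟨Or.inl he, fun h' => (h2 e he).ne (by rw [h'])⟩
    · right; right
      refine ⟨rfl, fun h' => ?_⟩
      simp only [keys, h1, List.map_append, List.mem_append, List.mem_map] at h'
      rcases h' with ⟨f, hf, h'⟩ | ⟨f, hf, h'⟩
      · exact (h2 f hf).ne (by rw [h'])
      · exact (h3 f hf).ne' (by rw [h'])
    · left
      exact ⟨Or.inr he, fun h' => (h3 e he).ne' (by rw [h'])⟩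

/-- The event queue when the segments with `P k` have been entered. -/
structure InitialQueue (s : Fin n → Segment ℝ) (P : Fin n → Prop)
    (Q : AVL ((ℝ × ℝ) × List (Fin n))) : Prop where
  bal : Q.Bal
  sorted : SortedQueue Q
  mem_keys : ∀ v, v ∈ keys Q ↔ ∃ k, P k ∧ (v = (s k).lo ∨ v = (s k).hi)
  starts : ∀ e ∈ Q.toList, e.2.Nodup ∧ ∀ k, k ∈ e.2 ↔ P k ∧ (s k).lo = e.1

theorem initQueue_spec (hs : Admissible s) (ks : List (Fin n)) :
    ∀ (P : Fin n → Prop) (Q : AVL ((ℝ × ℝ) × List (Fin n))), InitialQueue s P Q → ks.Nodup →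
      (∀ k ∈ ks, ¬ P k) →
      InitialQueue s (fun k => P k ∨ k ∈ ks) (initQueue s ks Q).val ∧
        (initQueue s ks Q).time ≤
          ks.length * (2 * (2 * heightBound (vertices s).ncard + 1)) + 1 := by
  have hlen : ∀ Q : AVL ((ℝ × ℝ) × List (Fin n)), Q.Bal → SortedQueue Q →
      (∀ v ∈ keys Q, v ∈ vertices s) → Q.height ≤ heightBound (vertices s).ncard :=
    fun Q hb hQ hv => hb.height_le (hQ.length_le hs.vertices_finite.1 hv)
  induction ks with
  | nil =>
    intro P Q hQ _ _
    simpa [initQueue] using hQ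
  | cons k ks ih =>
    intro P Q hQ hnd hP
    obtain ⟨hk, hnd⟩ := List.nodup_cons.1 hnd
    simp only [initQueue, Timed.bind_val, Timed.bind_time]
    have hvQ : ∀ v ∈ keys Q, v ∈ vertices s := by
      intro v hv
      obtain ⟨j, -, rfl | rfl⟩ := (hQ.mem_keys v).1 hv
      · exact lo_mem_vertices s j
      · exact hi_mem_vertices s j
    obtain ⟨b1, s1, k1, e1, t1⟩ := queue_insert_spec hQ.bal hQ.sorted (s k).lo [k]
      (fun e => (e.1, k :: e.2)) (fun _ => rfl) (Q' := addStart (s k).lo k Q) rfl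
    have hvQ₁ : ∀ v ∈ keys (addStart (s k).lo k Q).val, v ∈ vertices s := by
      intro v hv
      rcases (k1 v).1 hv with rfl | hv
      · exact lo_mem_vertices s k
      · exact hvQ v hv
    obtain ⟨b2, s2, k2, e2, t2⟩ := queue_insert_spec b1 s1 (s k).hi [] id (fun _ => rfl)
      (Q' := addPoint (s k).hi (addStart (s k).lo k Q).val) rfl
    have h1 := hlen _ hQ.bal hQ.sorted hvQ
    have h2 := hlen _ b1 s1 hvQ₁
    have hPk := hP k List.mem_cons_self
    have hlohi := lo_lt_hi (hs.nondegenerate k)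
    have hst : ∀ e ∈ (addStart (s k).lo k Q).val.toList,
        e.2.Nodup ∧ ∀ j, j ∈ e.2 ↔ (P j ∨ j = k) ∧ (s j).lo = e.1 := by
      intro e he
      rcases e1 e he with ⟨h, h'⟩ | ⟨f, hf, hfv, rfl⟩ | ⟨rfl, h⟩
      · refine ⟨(hQ.starts e h).1, fun j => ?_⟩
        rw [(hQ.starts e h).2 j]
        constructor
        · tauto
        · rintro ⟨hj | rfl, hj'⟩
          · exact ⟨hj, hj'⟩
          · exact absurd hj'.symm h'
      · refine ⟨List.nodup_cons.2 ⟨fun h => hPk (((hQ.starts f hf).2 k).1 h).1,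
          (hQ.starts f hf).1⟩, fun j => ?_⟩
        rw [List.mem_cons, (hQ.starts f hf).2 j]
        constructor
        · rintro (rfl | ⟨h, h'⟩)
          · exact ⟨Or.inr rfl, hfv.symm⟩
          · exact ⟨Or.inl h, h'⟩
        · rintro ⟨hj | rfl, hj'⟩
          · exact Or.inr ⟨hj, hj'⟩
          · exact Or.inl rfl
      · refine ⟨by simp, fun j => ?_⟩
        rw [List.mem_singleton]
        constructor
        · rintro rfl
          exact ⟨Or.inr rfl, rfl⟩
        · rintro ⟨hj | rfl, hj'⟩
          · exact absurd ((hQ.mem_keys _).2 ⟨j, hj, Or.inl hj'.symm⟩) h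
          · rfl
    obtain ⟨r1, r2⟩ := ih (fun j => P j ∨ j = k)
      (addPoint (s k).hi (addStart (s k).lo k Q).val).val
      { bal := b2
        sorted := s2
        mem_keys := by
          intro v
          rw [k2, k1, hQ.mem_keys]
          constructor
          · rintro (rfl | rfl | ⟨j, hj, h⟩)
            · exact ⟨k, Or.inr rfl, Or.inr rfl⟩
            · exact ⟨k, Or.inr rfl, Or.inl rfl⟩
            · exact ⟨j, Or.inl hj, h⟩
          · rintro ⟨j, hj | rfl, h⟩
            · exact Or.inr (Or.inr ⟨j, hj, h⟩)
            · tauto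
        starts := by
          intro e he
          rcases e2 e he with ⟨h, -⟩ | ⟨f, hf, -, rfl⟩ | ⟨rfl, h⟩
          · exact hst e h
          · exact hst _ hf
          · refine ⟨by simp, fun j => ?_⟩
            simp only [List.not_mem_nil, false_iff, not_and]
            rintro (hj | rfl) hj'
            · exact h ((k1 _).2 (Or.inr ((hQ.mem_keys _).2 ⟨j, hj, Or.inl hj'.symm⟩)))
            · exact hlohi.ne (congrArg toLex hj') }
      hnd (by
        rintro j hj (h | rfl)
        · exact hP j (List.mem_cons_of_mem _ hj) h
        · exact hk hj)
    refine ⟨?_, ?_⟩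
    · simpa only [List.mem_cons, or_assoc] using r1
    · simp only [List.length_cons, Nat.add_mul]
      omega

/-- The event queue after the event point `q`: it holds later vertices only, each with the segments
that start there, and all later end points. -/
structure QueueInv (s : Fin n → Segment ℝ) (q : ℝ × ℝ)
    (Q : AVL ((ℝ × ℝ) × List (Fin n))) : Prop where
  bal : Q.Bal
  sorted : SortedQueue Q
  vertex : ∀ v ∈ keys Q, v ∈ vertices s ∧ toLex q < toLex v
  starts : ∀ e ∈ Q.toList, e.2.Nodup ∧ ∀ k, k ∈ e.2 ↔ (s k).lo = e.1
  lo_mem : ∀ k, toLex q < toLex (s k).lo → (s k).lo ∈ keys Q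
  hi_mem : ∀ k, toLex q < toLex (s k).hi → (s k).hi ∈ keys Q

theorem QueueInv.length_le (hs : Admissible s) {q : ℝ × ℝ}
    {Q : AVL ((ℝ × ℝ) × List (Fin n))} (hQ : QueueInv s q Q) :
    Q.toList.length ≤ (vertices s).ncard :=
  hQ.sorted.length_le hs.vertices_finite.1 fun v hv => (hQ.vertex v hv).1

theorem QueueInv.addPoint (hs : Admissible s) {q : ℝ × ℝ}
    {Q : AVL ((ℝ × ℝ) × List (Fin n))} (hQ : QueueInv s q Q) {v : ℝ × ℝ} (hv : v ∈ vertices s)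
    (hqv : toLex q < toLex v) :
    QueueInv s q (addPoint v Q).val ∧ (∀ x, x ∈ keys (addPoint v Q).val ↔ x = v ∨ x ∈ keys Q) ∧
      (GuardSegments.addPoint v Q).time ≤ 2 * heightBound (vertices s).ncard + 1 := by
  obtain ⟨b1, s1, k1, e1, t1⟩ := queue_insert_spec hQ.bal hQ.sorted v [] id (fun _ => rfl)
    (Q' := GuardSegments.addPoint v Q) rfl
  have h1 := hQ.bal.height_le (hQ.length_le hs)
  refine ⟨⟨b1, s1, ?_, ?_, ?_, ?_⟩, k1, by omega⟩
  · intro x hx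
    rcases (k1 x).1 hx with rfl | hx
    · exact ⟨hv, hqv⟩
    · exact hQ.vertex x hx
  · intro e he
    rcases e1 e he with ⟨h, -⟩ | ⟨f, hf, -, rfl⟩ | ⟨rfl, h⟩
    · exact hQ.starts e h
    · exact hQ.starts _ hf
    · -- a new point is not a starting point, since all of those have been in the queue before
      refine ⟨by simp, fun k => ?_⟩
      simp only [List.not_mem_nil, false_iff]
      rintro rfl
      exact h (hQ.lo_mem k hqv)
  · exact fun k hk => (k1 _).2 (Or.inr (hQ.lo_mem k hk))
  · exact fun k hk => (k1 _).2 (Or.inr (hQ.hi_mem k hk))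

theorem schedule_spec (hs : Admissible s) {q : ℝ × ℝ} (o : Option (Fin n)) (ks : List (Fin n)) :
    ∀ Q : AVL ((ℝ × ℝ) × List (Fin n)), QueueInv s q Q →
      (∀ j ∈ o, toLex (s j).lo ≤ toLex q) → (∀ k ∈ ks, toLex (s k).lo ≤ toLex q) →
      (∀ j ∈ o, ∀ k ∈ ks, j ≠ k) →
      QueueInv s q (schedule s q o ks Q).val ∧ (keys Q ⊆ keys (schedule s q o ks Q).val) ∧
      (∀ j ∈ o, ∀ k ∈ ks, ∀ v ∈ (s j).points, v ∈ (s k).points → toLex q < toLex v →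
        v ∈ keys (schedule s q o ks Q).val) ∧
      (schedule s q o ks Q).time ≤
        ks.length * (2 * heightBound (vertices s).ncard + 2) + 1 := by
  induction ks with
  | nil =>
    intro Q hQ _ _ _
    refine ⟨by simpa [schedule] using hQ, by simp [schedule], by simp, by simp [schedule]⟩
  | cons k ks ih =>
    intro Q hQ ho hks hne
    simp only [schedule, Timed.bind_val, Timed.bind_time, step_val, step_time]
    have hmeet : ∀ j ∈ o, ∀ v ∈ (s j).points, v ∈ (s k).points → toLex q < toLex v →
        (o.bind fun j => (s j).meet (s k)) = some v := by
      intro j hj v hv hv' hqv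
      rw [Option.mem_def.1 hj, Option.bind_some]
      exact meet_eq_some (hs.cross_ne_zero_of_lo_lt (hne j hj k List.mem_cons_self) hv hv'
        ((ho j hj).trans_lt hqv) ((hks k List.mem_cons_self).trans_lt hqv)) hv hv'
    have ho' : ∀ k ∈ ks, toLex (s k).lo ≤ toLex q := fun k hk => hks k (List.mem_cons_of_mem _ hk)
    have hne' : ∀ j ∈ o, ∀ k ∈ ks, j ≠ k := fun j hj k hk => hne j hj k (List.mem_cons_of_mem _ hk)
    rcases hm : (o.bind fun j => (s j).meet (s k)) with _ | v
    · obtain ⟨r1, r2, r3, r4⟩ := ih Q hQ ho ho' hne'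
      refine ⟨r1, r2, ?_, ?_⟩
      · intro j hj k' hk' v hv hv' hqv
        rcases List.mem_cons.1 hk' with rfl | hk'
        · simp [hmeet j hj v hv hv' hqv] at hm
        · exact r3 j hj k' hk' v hv hv' hqv
      · simp only [List.length_cons, Nat.add_mul]
        omega
    · obtain ⟨j₀, hj₀, hjk⟩ := Option.bind_eq_some_iff.1 hm
      have hmem := meet_mem hjk
      have hvert := mem_vertices_of_mem (hne j₀ hj₀ k List.mem_cons_self) hmem.1 hmem.2
      dsimp only
      split_ifs with hqv
      · rw [lexCmp_eq_lt] at hqv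
        obtain ⟨a1, a2, a3⟩ := hQ.addPoint hs hvert hqv
        obtain ⟨r1, r2, r3, r4⟩ := ih _ a1 ho ho' hne'
        refine ⟨r1, fun x hx => r2 ((a2 x).2 (Or.inr hx)), ?_, ?_⟩
        · intro j hj k' hk' v' hv hv' hqv
          rcases List.mem_cons.1 hk' with rfl | hk'
          · rw [hmeet j hj v' hv hv' hqv, Option.some.injEq] at hm
            exact r2 ((a2 v').2 (Or.inl hm))
          · exact r3 j hj k' hk' v' hv hv' hqv
        · simp only [List.length_cons, Nat.add_mul, Timed.bind_time]
          omega
      · rw [lexCmp_eq_lt] at hqv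
        obtain ⟨r1, r2, r3, r4⟩ := ih _ hQ ho ho' hne'
        refine ⟨r1, r2, ?_, ?_⟩
        · intro j hj k' hk' v' hv hv' hqv'
          rcases List.mem_cons.1 hk' with rfl | hk'
          · rw [hmeet j hj v' hv hv' hqv', Option.some.injEq] at hm
            exact absurd (hm ▸ hqv') hqv
          · exact r3 j hj k' hk' v' hv hv' hqv'
        · simp only [List.length_cons, Nat.add_mul, Timed.bind_time, step_val, step_time]
          omega

/-- The part of the treatment of an event point that schedules the intersection points of segments
which become neighbours. -/
noncomputable def scheduleNeighbours (s : Fin n → Segment ℝ) (q : ℝ × ℝ)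
    (below above : Option (Fin n)) (new : List (Fin n)) (Q : AVL ((ℝ × ℝ) × List (Fin n))) :
    Timed (AVL ((ℝ × ℝ) × List (Fin n))) :=
  match new with
  | [] => schedule s q below above.toList Q
  | _ => do
    let Q₁ ← schedule s q below new Q
    schedule s q above new Q₁

theorem scheduleNeighbours_spec (hs : Admissible s) {q : ℝ × ℝ} {below above : Option (Fin n)}
    {new : List (Fin n)} {Q : AVL ((ℝ × ℝ) × List (Fin n))} (hQ : QueueInv s q Q)
    (hb : ∀ j ∈ below, toLex (s j).lo ≤ toLex q) (ha : ∀ j ∈ above, toLex (s j).lo ≤ toLex q)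
    (hnew : ∀ j ∈ new, toLex (s j).lo ≤ toLex q) (hba : ∀ j ∈ below, ∀ k ∈ above, j ≠ k)
    (hbn : ∀ j ∈ below, j ∉ new) (han : ∀ j ∈ above, j ∉ new)
    {Q' : Timed (AVL ((ℝ × ℝ) × List (Fin n)))}
    (hQ' : Q' = scheduleNeighbours s q below above new Q) :
    QueueInv s q Q'.val ∧ keys Q ⊆ keys Q'.val ∧
    (new = [] → ∀ j ∈ below, ∀ k ∈ above, ∀ v ∈ (s j).points, v ∈ (s k).points →
      toLex q < toLex v → v ∈ keys Q'.val) ∧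
    (∀ j ∈ below, ∀ k ∈ new, ∀ v ∈ (s j).points, v ∈ (s k).points →
      toLex q < toLex v → v ∈ keys Q'.val) ∧
    (∀ j ∈ above, ∀ k ∈ new, ∀ v ∈ (s j).points, v ∈ (s k).points →
      toLex q < toLex v → v ∈ keys Q'.val) ∧
    Q'.time ≤ (2 * new.length + 1) * (2 * heightBound (vertices s).ncard + 2) + 2 := by
  subst hQ'
  rcases new with _ | ⟨x, xs⟩
  · obtain ⟨r1, r2, r3, r4⟩ := schedule_spec hs below above.toList Q hQ hb
      (by simpa using ha) (by simpa using hba)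
    refine ⟨r1, r2, fun _ j hj k hk => r3 j hj k (by simpa using hk), by simp, by simp, ?_⟩
    have : above.toList.length ≤ 1 := by cases above <;> simp
    have h2 := Nat.mul_le_mul_right (2 * heightBound (vertices s).ncard + 2) this
    simp only [scheduleNeighbours, List.length_nil]
    omega
  · obtain ⟨r1, r2, r3, r4⟩ := schedule_spec hs below (x :: xs) Q hQ hb hnew
      (fun j hj k hk h => hbn j hj (h ▸ hk))
    obtain ⟨r1', r2', r3', r4'⟩ := schedule_spec hs above (x :: xs) _ r1 ha hnew
      (fun j hj k hk h => han j hj (h ▸ hk))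
    refine ⟨r1', fun v hv => r2' (r2 hv), by simp, ?_, r3', ?_⟩
    · exact fun j hj k hk v hv hv' hqv => r2' (r3 j hj k hk v hv hv' hqv)
    · simp only [scheduleNeighbours, Timed.bind_time]
      have : (2 * (x :: xs).length + 1) * (2 * heightBound (vertices s).ncard + 2) =
        2 * ((x :: xs).length * (2 * heightBound (vertices s).ncard + 2)) +
          (2 * heightBound (vertices s).ncard + 2) := by ring
      omega

/-! ### Counting neighbours in a list -/

open Classical in
/-- The number of pairs of neighbours in a list that satisfy `P`. -/
noncomputable def adjCount {α : Type} (P : α → α → Prop) : List α → ℕ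
  | a :: b :: l => (if P a b then 1 else 0) + adjCount P (b :: l)
  | _ => 0

section adjCount

variable {α : Type} {P P' : α → α → Prop}

@[simp] theorem adjCount_nil : adjCount P [] = 0 := by simp [adjCount]

theorem adjCount_cons_le (a : α) (l : List α) : adjCount P (a :: l) ≤ adjCount P l + 1 := by
  cases l with
  | nil => simp [adjCount]
  | cons b l =>
    simp only [adjCount]
    split_ifs <;> omega

theorem le_adjCount_cons (a : α) (l : List α) : adjCount P l ≤ adjCount P (a :: l) := by
  cases l with
  | nil => simp
  | cons b l =>
    simp only [adjCount]
    omega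

theorem adjCount_append_le (l l' : List α) :
    adjCount P (l ++ l') ≤ adjCount P l + adjCount P l' + 1 := by
  induction l with
  | nil => simp
  | cons a l ih =>
    cases l with
    | nil =>
      have := adjCount_cons_le (P := P) a l'
      simp only [List.cons_append, List.nil_append]
      omega
    | cons b l =>
      simp only [List.cons_append, adjCount] at ih ⊢
      omega

theorem le_adjCount_append (l l' : List α) :
    adjCount P l + adjCount P l' ≤ adjCount P (l ++ l') := by
  induction l with
  | nil => simp
  | cons a l ih =>
    cases l with
    | nil =>
      have := le_adjCount_cons (P := P) a l'
      simpa [adjCount] using this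
    | cons b l =>
      simp only [List.cons_append, adjCount] at ih ⊢
      omega

theorem adjCount_mono (h : ∀ a b, P a b → P' a b) (l : List α) :
    adjCount P l ≤ adjCount P' l := by
  induction l with
  | nil => simp
  | cons a l ih =>
    cases l with
    | nil => simp [adjCount]
    | cons b l =>
      have := h a b
      simp only [adjCount]
      split_ifs <;> first | omega | tauto

theorem adjCount_eq_zero {l : List α} (h : l.Pairwise fun a b => ¬ P a b) :
    adjCount P l = 0 := by
  induction l with
  | nil => simp
  | cons a l ih =>
    cases l with
    | nil => simp [adjCount]
    | cons b l =>
      have := (List.pairwise_cons.1 h)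
      simp [adjCount, ih this.2, this.1 b]

theorem length_le_adjCount {l : List α} (h : l.Pairwise P) : l.length ≤ adjCount P l + 1 := by
  induction l with
  | nil => simp
  | cons a l ih =>
    cases l with
    | nil => simp [adjCount]
    | cons b l =>
      have := (List.pairwise_cons.1 h)
      have i := ih this.2
      simp only [adjCount, this.1 b (by simp), if_true, List.length_cons] at i ⊢
      omega

end adjCount

/-! ### The status and the treatment of an event point -/

/-- The status contains, in their order on the sweep line, the segments that are met immediately
after `q`, and the later intersection points of neighbours are scheduled. -/
structure SweepInv (s : Fin n → Segment ℝ) (q : ℝ × ℝ) (Q : AVL ((ℝ × ℝ) × List (Fin n)))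
    (T : AVL (Fin n)) : Prop extends QueueInv s q Q where
  status_bal : T.Bal
  status_nodup : T.toList.Nodup
  mem_status : ∀ k, k ∈ T.toList ↔ toLex (s k).lo ≤ toLex q ∧ toLex q < toLex (s k).hi
  below : T.toList.Pairwise fun j k => Below q (s j) (s k)
  adjacent : T.toList.IsChain fun j k =>
    ∀ v ∈ (s j).points, v ∈ (s k).points → toLex q < toLex v → v ∈ keys Q

/-- `q'` is the first vertex after `q`. -/
structure NextVertex (s : Fin n → Segment ℝ) (q q' : ℝ × ℝ) : Prop where
  vertex : q' ∈ vertices s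
  lt : toLex q < toLex q'
  le : ∀ v ∈ vertices s, toLex q < toLex v → toLex q' ≤ toLex v

namespace SweepInv

variable {q q' : ℝ × ℝ} {Q : AVL ((ℝ × ℝ) × List (Fin n))} {T : AVL (Fin n)}

theorem directed (h : SweepInv s q Q T) (hq : NextVertex s q q') :
    Directed (fun k => (s k).side q') T.toList := by
  have h1 := h.status_nodup.and h.below
  refine List.Pairwise.imp_of_mem ?_ h1
  rintro j k hj hk ⟨hjk, hb⟩
  refine hb q' hq.lt (hq.le _ (hi_mem_vertices s j) ((h.mem_status j).1 hj).2)
    (hq.le _ (hi_mem_vertices s k) ((h.mem_status k).1 hk).2) fun v hv hv' h1 h2 => ?_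
  exact h2.not_ge (hq.le v (mem_vertices_of_mem hjk hv hv') h1)

theorem mem_points_of_side (hs : Admissible s) (h : SweepInv s q Q T) (hq : NextVertex s q q')
    {k : Fin n} (hk : k ∈ T.toList) (hside : (s k).side q' = .eq) : q' ∈ (s k).points := by
  have h1 := (h.mem_status k).1 hk
  exact (mem_points_iff (hs.nondegenerate k)).2
    ⟨hside, h1.1.trans hq.lt.le, hq.le _ (hi_mem_vertices s k) h1.2⟩

/-- The segments through the next vertex are found in the status, unless they start there. -/
theorem mem_points_iff_status (hs : Admissible s) (h : SweepInv s q Q T)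
    (hq : NextVertex s q q') (k : Fin n) :
    q' ∈ (s k).points ↔ (k ∈ T.toList ∧ (s k).side q' = .eq) ∨ (s k).lo = q' := by
  constructor
  · intro hk
    have h1 := (mem_points_iff (hs.nondegenerate k)).1 hk
    rcases h1.2.1.eq_or_lt with h2 | h2
    · exact Or.inr (by simpa using h2)
    · left
      refine ⟨(h.mem_status k).2 ⟨?_, hq.lt.trans_le h1.2.2⟩, h1.1⟩
      by_contra! h3
      exact h2.not_ge (hq.le _ (lo_mem_vertices s k) h3)
  · rintro (⟨hk, hside⟩ | rfl)
    · exact h.mem_points_of_side hs hq hk hside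
    · exact (s k).lo_mem

/-- If the next vertex is an inner point of two segments, then these are consecutive, up to other
segments through this vertex, in the status, so it has been scheduled. -/
theorem next_mem_keys (hs : Admissible s) (h : SweepInv s q Q T) (hq : NextVertex s q q') :
    q' ∈ keys Q := by
  rcases vertex_cases hs hq.vertex with ⟨k, rfl | rfl⟩ | ⟨i, j, hij, hi, hj, hi', hj'⟩
  · exact h.lo_mem k hq.lt
  · exact h.hi_mem k hq.lt
  · have hB : ∀ k, q' ∈ (s k).points → toLex (s k).lo < toLex q' →
        k ∈ T.toList.filter (fun k => (s k).side q' = .eq) := by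
      intro k hk hlo
      rcases (h.mem_points_iff_status hs hq k).1 hk with ⟨h1, h2⟩ | h1
      · simpa using ⟨h1, h2⟩
      · exact absurd (congrArg toLex h1) hlo.ne
    have hiB := hB i hi hi'.1
    have hjB := hB j hj hj'.1
    have hT := (h.directed hq).eq_append
    rcases hBeq : T.toList.filter (fun k => (s k).side q' = .eq) with _ | ⟨x, _ | ⟨y, B⟩⟩
    · simp [hBeq] at hiB
    · rw [hBeq, List.mem_singleton] at hiB hjB
      exact absurd (hiB.trans hjB.symm) hij
    · have hpts : ∀ k ∈ x :: y :: B, q' ∈ (s k).points := by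
        intro k hk
        rw [← hBeq] at hk
        simp only [List.mem_filter, decide_eq_true_eq] at hk
        exact h.mem_points_of_side hs hq hk.1 hk.2
      have hadj := h.adjacent
      rw [hT, hBeq] at hadj
      have h2 := hadj.left_of_append.right_of_append
      rw [List.isChain_cons_cons] at h2
      exact h2.1 q' (hpts x (by simp)) (hpts y (by simp)) hq.lt

end SweepInv

theorem exists_nextVertex (hs : Admissible s) {q v : ℝ × ℝ} (hv : v ∈ vertices s)
    (hqv : toLex q < toLex v) : ∃ q', NextVertex s q q' := by
  have hfin : {v | v ∈ vertices s ∧ toLex q < toLex v}.Finite :=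
    hs.vertices_finite.1.subset fun _ h => h.1
  obtain ⟨m, hm, hmin⟩ := Set.exists_min_image _ toLex hfin ⟨v, hv, hqv⟩
  exact ⟨m, hm.1, hm.2, fun v hv hqv => hmin v ⟨hv, hqv⟩⟩

/-- The first event point in the queue is the next vertex. -/
theorem SweepInv.nextVertex_head (hs : Admissible s) {q : ℝ × ℝ}
    {Q : AVL ((ℝ × ℝ) × List (Fin n))} {T : AVL (Fin n)} (h : SweepInv s q Q T)
    {e : (ℝ × ℝ) × List (Fin n)} {l : List ((ℝ × ℝ) × List (Fin n))} (hQ : Q.toList = e :: l) :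
    NextVertex s q e.1 := by
  have he : e.1 ∈ keys Q := by simp [keys, hQ]
  obtain ⟨h1, h2⟩ := h.vertex _ he
  obtain ⟨q', hq'⟩ := exists_nextVertex hs h1 h2
  have h3 := h.next_mem_keys hs hq'
  have h4 : toLex e.1 ≤ toLex q' := by
    have hsort := h.sorted
    rw [SortedQueue, hQ, List.pairwise_cons] at hsort
    simp only [keys, hQ, List.map_cons, List.mem_cons, List.mem_map] at h3
    rcases h3 with rfl | ⟨f, hf, rfl⟩
    · exact le_rfl
    · exact (hsort.1 f hf).le
  have h5 : q' = e.1 := by simpa using le_antisymm (hq'.le _ h1 h2) h4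
  rwa [h5] at hq'

theorem extract_spec (s : Fin n → Segment ℝ) (q : ℝ × ℝ) (N : ℕ) (fuel : ℕ) :
    ∀ T : AVL (Fin n), T.Bal → Directed (fun k => (s k).side q) T.toList →
      (T.toList.filter fun k => (s k).side q = .eq).length ≤ fuel → T.toList.length ≤ N →
      (extract s q fuel T).val.1.Perm (T.toList.filter fun k => (s k).side q = .eq) ∧
      (extract s q fuel T).val.2.toList = (T.toList.filter fun k => (s k).side q = .gt) ++
        (T.toList.filter fun k => (s k).side q = .lt) ∧
      (extract s q fuel T).val.2.Bal ∧
      (extract s q fuel T).time ≤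
        ((T.toList.filter fun k => (s k).side q = .eq).length + 1) * (2 * heightBound N + 2) := by
  induction fuel with
  | zero =>
    intro T hb hd hf hN
    have h0 : (T.toList.filter fun k => (s k).side q = .eq) = [] := by
      simpa only [Nat.le_zero, List.length_eq_zero_iff] using hf
    have hT := hd.eq_append
    rw [h0, List.append_nil] at hT
    refine ⟨by simp [extract, h0], by simpa [extract] using hT, by simpa [extract] using hb, ?_⟩
    simp only [extract, step_time, h0, List.length_nil]
    omega
  | succ fuel ih =>
    intro T hb hd hf hN
    have htime := remove_time_le (fun k => (s k).side q) hb
    have hheight := hb.height_le hN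
    simp only [extract, Timed.bind_val, Timed.bind_time]
    rcases remove_toList (fun k => (s k).side q) hd with
      ⟨h1, h2⟩ | ⟨y, T', l₁, l₂, h1, h2, h3, h4⟩
    · have h0 : (T.toList.filter fun k => (s k).side q = .eq) = [] := by
        simpa [List.filter_eq_nil_iff] using h2
      have hT := hd.eq_append
      rw [h0, List.append_nil] at hT
      simp only [h1, step_val, step_time, h0]
      refine ⟨List.Perm.refl _, hT, hb, ?_⟩
      simp only [List.length_nil]
      omega
    · have hb' := (remove_bal _ hb h1).1
      have hd' : Directed (fun k => (s k).side q) T'.toList := by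
        rw [h4]
        rw [h3] at hd
        exact List.Pairwise.sublist (by simp) hd
      have hperm : T.toList.Perm (y :: T'.toList) := by
        rw [h3, h4]
        exact List.perm_middle
      have hpeq := hperm.filter (fun k => (s k).side q = .eq)
      rw [List.filter_cons_of_pos (by simpa using h2)] at hpeq
      have hlen := hperm.length_eq
      rw [List.length_cons] at hlen
      have hleneq := hpeq.length_eq
      rw [List.length_cons] at hleneq
      obtain ⟨r1, r2, r3, r4⟩ := ih T' hb' hd' (by omega) (by omega)
      simp only [h1, Timed.bind_val, Timed.bind_time, step_val, step_time]
      refine ⟨(r1.cons y).trans hpeq.symm, ?_, r3, ?_⟩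
      · rw [r2, h3, h4]
        simp [h2]
      · rw [hleneq, Nat.add_mul (_ + 1)]
        omega

theorem survivors_val (s : Fin n → Segment ℝ) (q : ℝ × ℝ) (ks acc : List (Fin n)) :
    (survivors s q ks acc).val = (ks.filter fun k => (s k).hi ≠ q).reverse ++ acc := by
  induction ks generalizing acc with
  | nil => simp [survivors]
  | cons k ks ih =>
    simp only [survivors, Timed.bind_val, step_val, ih]
    by_cases h : (s k).hi = q <;> simp [h]

theorem survivors_time (s : Fin n → Segment ℝ) (q : ℝ × ℝ) (ks acc : List (Fin n)) :
    (survivors s q ks acc).time = ks.length + 1 := by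
  induction ks generalizing acc with
  | nil => simp [survivors]
  | cons k ks ih =>
    simp only [survivors, Timed.bind_time, ih, List.length_cons, step_time]
    omega

/-- The number of pairs of neighbours in a status that have crossed, or started from a common
point, up to `q`. -/
noncomputable def crossed (s : Fin n → Segment ℝ) (q : ℝ × ℝ) (l : List (Fin n)) : ℕ :=
  adjCount (fun j k => ∃ v ∈ (s j).points, v ∈ (s k).points ∧ toLex v ≤ toLex q) l

/-- The new status at an event point. -/
theorem SweepInv.status_step (hs : Admissible s) {q q' : ℝ × ℝ}
    {Q : AVL ((ℝ × ℝ) × List (Fin n))} {T : AVL (Fin n)} (h : SweepInv s q Q T)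
    (hq : NextVertex s q q') {M : List (Fin n)} (hMnd : M.Nodup)
    (hM : ∀ k, k ∈ M ↔ q' ∈ (s k).points ∧ toLex q' < toLex (s k).hi)
    (hMslope : M.Pairwise fun j k => 0 < cross (s j).dir (s k).dir)
    {l : List (Fin n)}
    (hl : l = T.toList.filter (fun k => (s k).side q' = .gt) ++ M ++
      T.toList.filter (fun k => (s k).side q' = .lt)) :
    l.Nodup ∧
    (∀ k, k ∈ l ↔ toLex (s k).lo ≤ toLex q' ∧ toLex q' < toLex (s k).hi) ∧
    (l.Pairwise fun j k => Below q' (s j) (s k)) ∧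
    l.length + (T.toList.filter fun k => (s k).side q' = .eq).length =
      T.toList.length + M.length ∧
    M.length + crossed s q T.toList ≤ crossed s q' l + 3 := by
  have hT := (h.directed hq).eq_append
  set A := T.toList.filter (fun k => (s k).side q' = .gt) with hAdef
  set B := T.toList.filter (fun k => (s k).side q' = .eq) with hBdef
  set C := T.toList.filter (fun k => (s k).side q' = .lt) with hCdef
  have hA : ∀ k ∈ A, k ∈ T.toList ∧ (s k).side q' = .gt := by simp [hAdef]
  have hB : ∀ k ∈ B, k ∈ T.toList ∧ (s k).side q' = .eq := by simp [hBdef]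
  have hC : ∀ k ∈ C, k ∈ T.toList ∧ (s k).side q' = .lt := by simp [hCdef]
  have hMside : ∀ k ∈ M, (s k).side q' = .eq := fun k hk =>
    ((mem_points_iff (hs.nondegenerate k)).1 ((hM k).1 hk).1).1
  have hMlo : ∀ k ∈ M, toLex (s k).lo ≤ toLex q' := fun k hk =>
    ((mem_points_iff (hs.nondegenerate k)).1 ((hM k).1 hk).1).2.1
  have hTlo : ∀ k ∈ T.toList, toLex (s k).lo ≤ toLex q' := fun k hk =>
    ((h.mem_status k).1 hk).1.trans hq.lt.le
  have hAC : (A ++ C).Sublist T.toList := by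
    rw [hT]
    simp
  -- segments that avoid the new vertex keep their order
  have hACbelow : (A ++ C).Pairwise fun j k => Below q' (s j) (s k) := by
    refine List.Pairwise.imp_of_mem ?_ ((h.status_nodup.and h.below).sublist hAC)
    rintro j k hj - ⟨hjk, hb⟩
    refine hb.mono hq.lt fun v hv hv' h1 h2 => ?_
    have h3 := hq.le v (mem_vertices_of_mem hjk hv hv') h1
    have h4 : q' = v := by simpa using le_antisymm h3 h2
    subst h4
    have h5 := ((mem_points_iff (hs.nondegenerate j)).1 hv).1
    rcases List.mem_append.1 hj with hj | hj
    · simp [(hA j hj).2] at h5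
    · simp [(hC j hj).2] at h5
  have hACnd := h.status_nodup.sublist hAC
  obtain ⟨nA, nC, nAC⟩ := List.nodup_append'.1 hACnd
  obtain ⟨bA, bC, bAC⟩ := List.pairwise_append.1 hACbelow
  subst hl
  refine ⟨?_, ?_, ?_, ?_, ?_⟩
  · refine List.nodup_append'.2 ⟨List.nodup_append'.2 ⟨nA, hMnd, ?_⟩, nC, ?_⟩
    · intro k hk hk'
      have := (hA k hk).2
      simp [hMside k hk'] at this
    · intro k hk hk'
      rcases List.mem_append.1 hk with hk | hk
      · exact nAC hk hk'
      · have := (hC k hk').2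
        simp [hMside k hk] at this
  · intro k
    constructor
    · have key : ∀ k ∈ T.toList, (s k).side q' ≠ .eq →
          toLex (s k).lo ≤ toLex q' ∧ toLex q' < toLex (s k).hi := by
        intro k hk hside
        refine ⟨hTlo k hk, lt_of_le_of_ne
          (hq.le _ (hi_mem_vertices s k) ((h.mem_status k).1 hk).2) fun h' => ?_⟩
        have h'' : q' = (s k).hi := by simpa using h'
        exact hside (h'' ▸ ((mem_points_iff (hs.nondegenerate k)).1 (s k).hi_mem).1)
      intro hk
      rcases List.mem_append.1 hk with hk | hk
      · rcases List.mem_append.1 hk with hk | hk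
        · exact key k (hA k hk).1 (by simp [(hA k hk).2])
        · exact ⟨hMlo k hk, ((hM k).1 hk).2⟩
      · exact key k (hC k hk).1 (by simp [(hC k hk).2])
    · rintro ⟨h1, h2⟩
      by_cases hk : q' ∈ (s k).points
      · simp [(hM k).2 ⟨hk, h2⟩]
      · have h3 : toLex (s k).lo < toLex q' := lt_of_le_of_ne h1 fun h' => hk (by
          have h'' : (s k).lo = q' := by simpa using h'
          exact h'' ▸ (s k).lo_mem)
        have h4 : k ∈ T.toList := by
          refine (h.mem_status k).2 ⟨?_, hq.lt.trans h2⟩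
          by_contra! h5
          exact h3.not_ge (hq.le _ (lo_mem_vertices s k) h5)
        rw [hT] at h4
        simp only [List.mem_append] at h4 ⊢
        rcases h4 with (h4 | h4) | h4
        · exact Or.inl (Or.inl h4)
        · exact absurd (h.mem_points_of_side hs hq (hB k h4).1 (hB k h4).2) hk
        · exact Or.inr h4
  · refine List.pairwise_append.2 ⟨List.pairwise_append.2 ⟨bA, ?_, ?_⟩, bC, ?_⟩
    · exact List.Pairwise.imp_of_mem (fun {j k} hj hk hjk =>
        below_of_slopes (hs.nondegenerate j) (hs.nondegenerate k) ((hM j).1 hj).1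
          ((hM k).1 hk).1 hjk) hMslope
    · intro j hj k hk
      have h1 := side_eq_gt.1 (hA j hj).2
      exact below_of_sides (hs.nondegenerate j) (hs.nondegenerate k) (hTlo j (hA j hj).1)
        (hMlo k hk) h1.le (side_eq_eq.1 (hMside k hk)).le (Or.inl h1)
    · intro j hj k hk
      rcases List.mem_append.1 hj with hj | hj
      · exact bAC j hj k hk
      · have h1 := side_eq_lt.1 (hC k hk).2
        exact below_of_sides (hs.nondegenerate j) (hs.nondegenerate k) (hMlo j hj)
          (hTlo k (hC k hk).1) (side_eq_eq.1 (hMside j hj)).ge h1.le (Or.inr h1)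
  · have h1 := congrArg List.length hT
    simp only [List.length_append] at h1 ⊢
    omega
  · -- old neighbours through the new vertex have not crossed before, new ones cross there
    have h1 : crossed s q B = 0 := by
      refine adjCount_eq_zero (List.Pairwise.imp_of_mem ?_
        (h.status_nodup.sublist List.filter_sublist))
      rintro j k hj hk hjk ⟨v, hvj, hvk, hvq⟩
      have h2 := hs.eq_of_mem hjk hvj hvk (h.mem_points_of_side hs hq (hB j hj).1 (hB j hj).2)
        (h.mem_points_of_side hs hq (hB k hk).1 (hB k hk).2)
      exact hq.lt.not_ge (h2 ▸ hvq)
    have h2 : M.length ≤ crossed s q' M + 1 := by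
      refine length_le_adjCount (List.Pairwise.imp_of_mem ?_ hMnd)
      intro j k hj hk _
      exact ⟨q', ((hM j).1 hj).1, ((hM k).1 hk).1, le_rfl⟩
    have h3 : ∀ l, crossed s q l ≤ crossed s q' l := fun l =>
      adjCount_mono (fun j k ⟨v, h1, h2, h3⟩ => ⟨v, h1, h2, h3.trans hq.lt.le⟩) l
    have h4 : crossed s q T.toList ≤ crossed s q A + crossed s q B + 1 + crossed s q C + 1 := by
      rw [hT]
      exact (adjCount_append_le _ _).trans (by have := adjCount_append_le (P := fun j k =>
        ∃ v ∈ (s j).points, v ∈ (s k).points ∧ toLex v ≤ toLex q) A B; unfold crossed; omega)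
    have h5 : crossed s q' A + crossed s q' M + crossed s q' C ≤ crossed s q' (A ++ M ++ C) :=
      le_trans (Nat.add_le_add_right (le_adjCount_append _ _) _) (le_adjCount_append _ _)
    have h6 := h3 A
    have h7 := h3 C
    omega

theorem handle_eq (s : Fin n → Segment ℝ) (q : ℝ × ℝ) (start : List (Fin n))
    (Q : AVL ((ℝ × ℝ) × List (Fin n))) (T : AVL (Fin n)) :
    handle s q start Q T = (do
      let r ← extract s q n T
      let below ← r.2.findBefore (fun k => step ((s k).side q)) none
      let above ← r.2.findAfter (fun k => step ((s k).side q)) none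
      let new ← survivors s q r.1 start
      let T' ← AVL.insertAll (statusCmp s q) new r.2
      let Q' ← scheduleNeighbours s q below above new Q
      let through ← append r.1 start
      step ⟨through, Q', T'⟩) := by
  have hext : ∀ a b : Timed (Handled ℝ n), a.val = b.val → a.time = b.time → a = b := by
    rintro ⟨_, _⟩ ⟨_, _⟩ rfl rfl
    rfl
  refine hext _ _ ?_ ?_
  · simp only [handle, Timed.bind_val]
    generalize (survivors s q (extract s q n T).val.1 start).val = new
    cases new <;> rfl
  · simp only [handle, Timed.bind_time]
    generalize (survivors s q (extract s q n T).val.1 start).val = new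
    cases new
    · rfl
    · simp only [scheduleNeighbours, Timed.bind_val, Timed.bind_time]
      omega

/-- The treatment of one event point. With `b` segments removed from the status and `m` segments
inserted, it takes `O((b + m + 1) log p)` steps; the number `m` is paid for by the growth of the
number of crossed neighbours, up to a constant. -/
theorem handle_spec (hs : Admissible s) {q : ℝ × ℝ} {Q Q' : AVL ((ℝ × ℝ) × List (Fin n))}
    {T : AVL (Fin n)} (h : SweepInv s q Q T) {e : (ℝ × ℝ) × List (Fin n)}
    (hQ' : Q'.Bal) (hQ : Q.toList = e :: Q'.toList) {H : ℕ} (hH1 : 1 ≤ H)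
    (hHn : heightBound n ≤ H) (hHp : heightBound (vertices s).ncard ≤ H)
    {r : Timed (Handled ℝ n)} (hr : r = handle s e.1 e.2 Q' T) :
    SweepInv s e.1 r.val.queue r.val.status ∧
    (r.val.through.Nodup ∧ ∀ k, k ∈ r.val.through ↔ e.1 ∈ (s k).points) ∧
    ∃ b m, r.val.through.length ≤ b + m ∧
      r.val.status.toList.length + b = T.toList.length + m ∧
      m + crossed s q T.toList ≤ crossed s e.1 r.val.status.toList + 3 ∧
      r.time ≤ 27 * H * (b + m + 1) := by
  have hq := h.nextVertex_head hs hQ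
  obtain ⟨q', start⟩ := e
  simp only at hq hr ⊢
  have hd := h.directed hq
  have hTn : T.toList.length ≤ n := by simpa using h.status_nodup.length_le_card
  -- the queue without the event point
  have hkeys : keys Q = q' :: keys Q' := by simp [keys, hQ]
  have hsort := h.sorted
  rw [SortedQueue, hQ, List.pairwise_cons] at hsort
  have hmemQ : ∀ v ∈ keys Q, toLex q' < toLex v → v ∈ keys Q' := by
    intro v hv hlt
    rw [hkeys, List.mem_cons] at hv
    exact hv.resolve_left (by rintro rfl; exact lt_irrefl _ hlt)
  have hQinv : QueueInv s q' Q' :=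
    { bal := hQ'
      sorted := hsort.2
      vertex := by
        intro v hv
        refine ⟨(h.vertex v (by rw [hkeys]; exact List.mem_cons_of_mem _ hv)).1, ?_⟩
        obtain ⟨f, hf, rfl⟩ := List.mem_map.1 hv
        exact hsort.1 f hf
      starts := fun f hf => h.starts f (by rw [hQ]; exact List.mem_cons_of_mem _ hf)
      lo_mem := fun k hk => hmemQ _ (h.lo_mem k (hq.lt.trans hk)) hk
      hi_mem := fun k hk => hmemQ _ (h.hi_mem k (hq.lt.trans hk)) hk }
  obtain ⟨hstnd, hst⟩ := h.starts (q', start) (by rw [hQ]; simp)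
  simp only at hstnd hst
  -- the parts of the status below, at, and above the event point
  obtain ⟨x1, x2, x3, x4⟩ := extract_spec s q' n n T h.status_bal hd
    ((List.length_filter_le _ _).trans hTn) hTn
  have hmemA : ∀ k, k ∈ T.toList.filter (fun k => (s k).side q' = .gt) ↔
      k ∈ T.toList ∧ (s k).side q' = .gt := by simp
  have hmemB : ∀ k, k ∈ T.toList.filter (fun k => (s k).side q' = .eq) ↔
      k ∈ T.toList ∧ (s k).side q' = .eq := by simp
  have hmemC : ∀ k, k ∈ T.toList.filter (fun k => (s k).side q' = .lt) ↔
      k ∈ T.toList ∧ (s k).side q' = .lt := by simp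
  have hstep := fun M hMnd hM hMslope l => h.status_step hs hq (M := M) hMnd hM hMslope (l := l)
  have hTeq := hd.eq_append
  set A := T.toList.filter (fun k => (s k).side q' = .gt) with hAdef
  set B := T.toList.filter (fun k => (s k).side q' = .eq) with hBdef
  set C := T.toList.filter (fun k => (s k).side q' = .lt) with hCdef
  set R := extract s q' n T with hR
  have hACsub : (A ++ C).Sublist T.toList := by
    rw [hTeq]
    simp
  have hdAC : Directed (fun k => (s k).side q') R.val.2.toList := by
    rw [x2]
    exact List.Pairwise.sublist hACsub hd
  have hRn : R.val.2.toList.length ≤ n := by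
    rw [x2]
    exact hACsub.length_le.trans hTn
  have hRheight := x3.height_le hRn
  have hbelow : (R.val.2.findBefore (fun k => step ((s k).side q')) none).val = A.getLast? := by
    rw [findBefore_val _ _ hdAC, x2, List.filter_append,
      List.filter_eq_self.2 (fun k hk => by simpa using ((hmemA k).1 hk).2),
      List.filter_eq_nil_iff.2 (fun k hk => by simp [((hmemC k).1 hk).2]), List.append_nil,
      Option.or_none]
  have habove : (R.val.2.findAfter (fun k => step ((s k).side q')) none).val = C.head? := by
    rw [findAfter_val _ _ hdAC, x2, List.filter_append,
      List.filter_eq_nil_iff.2 (fun k hk => by simp [((hmemA k).1 hk).2]),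
      List.filter_eq_self.2 (fun k hk => by simpa using ((hmemC k).1 hk).2), List.nil_append,
      Option.or_none]
  have htb := findBefore_time_le (fun k => (s k).side q') none x3
  have hta := findAfter_time_le (fun k => (s k).side q') none x3
  -- the segments that continue or start at the event point
  set new := (R.val.1.filter fun k => (s k).hi ≠ q').reverse ++ start with hnew
  have hBnd : R.val.1.Nodup := (x1.nodup_iff).2 (h.status_nodup.sublist List.filter_sublist)
  have hmemR : ∀ k, k ∈ R.val.1 ↔ k ∈ T.toList ∧ (s k).side q' = .eq := fun k =>
    x1.mem_iff.trans (hmemB k)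
  have hdisj : ∀ k ∈ R.val.1, k ∉ start := by
    intro k hk hk'
    have h1 := ((h.mem_status k).1 ((hmemR k).1 hk).1).1
    rw [(hst k).1 hk'] at h1
    exact hq.lt.not_ge h1
  have hnewnd : new.Nodup := by
    refine List.nodup_append'.2 ⟨List.nodup_reverse.2 (hBnd.filter _), hstnd, fun k hk hk' => ?_⟩
    rw [List.mem_reverse, List.mem_filter] at hk
    exact hdisj k hk.1 hk'
  have hmemnew : ∀ k, k ∈ new ↔ q' ∈ (s k).points ∧ toLex q' < toLex (s k).hi := by
    intro k
    rw [h.mem_points_iff_status hs hq k, hnew, List.mem_append, List.mem_reverse, List.mem_filter,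
      hmemR, hst, decide_eq_true_eq]
    constructor
    · rintro (⟨h1, h2⟩ | h1)
      · exact ⟨Or.inl h1, lt_of_le_of_ne
          (hq.le _ (hi_mem_vertices s k) ((h.mem_status k).1 h1.1).2) (by simpa using Ne.symm h2)⟩
      · exact ⟨Or.inr h1, h1 ▸ lo_lt_hi (hs.nondegenerate k)⟩
    · rintro ⟨h1 | h1, h2⟩
      · exact Or.inl ⟨h1, fun h3 => h2.ne (congrArg toLex h3.symm)⟩
      · exact Or.inr h1
  have hnewside : ∀ k ∈ new, (s k).side q' = .eq := fun k hk =>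
    ((mem_points_iff (hs.nondegenerate k)).1 ((hmemnew k).1 hk).1).1
  have hACn : ∀ k ∈ A ++ C, k ∉ new := by
    intro k hk hk'
    rcases List.mem_append.1 hk with hk | hk
    · have := ((hmemA k).1 hk).2
      simp [hnewside k hk'] at this
    · have := ((hmemC k).1 hk).2
      simp [hnewside k hk'] at this
  have hlen : new.length + (A ++ C).length ≤ n := by
    have : (new ++ (A ++ C)).Nodup := List.nodup_append'.2
      ⟨hnewnd, h.status_nodup.sublist hACsub, fun k hk hk' => hACn k hk' hk⟩
    simpa using this.length_le_card
  obtain ⟨M, m1, m2, m3, m4, m5⟩ := insertAll_spec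
    (fun k j => ((s j).side q').then ((s k).slopeCmp (s j)))
    (fun j k => 0 < cross (s j).dir (s k).dir) (fun k => by simp [cross_self])
    (fun i j k h1 h2 => cross_pos_trans (dir_lexPos (hs.nondegenerate i))
      (dir_lexPos (hs.nondegenerate j)) (dir_lexPos (hs.nondegenerate k)) h1 h2.le)
    A C n new [] R.val.2 x3 (by simpa using x2) List.Pairwise.nil (by simpa using hnewnd)
    (fun k _ j hj => by simp [((hmemA j).1 hj).2]) (fun k _ j hj => by simp [((hmemC j).1 hj).2])
    (by
      intro j hj k hk hjk
      rw [List.append_nil] at hk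
      have h1 := hs.cross_ne_zero_of_lt_hi hjk ((hmemnew j).1 hj).1 ((hmemnew k).1 hk).1
        ((hmemnew j).1 hj).2 ((hmemnew k).1 hk).2
      simp only [hnewside k hk, Ordering.eq_then, slopeCmp]
      rcases lt_or_gt_of_ne h1 with h2 | h2
      · left
        rw [compare_gt_iff_gt, cross_anticomm]
        exact ⟨by linarith, by linarith⟩
      · right
        rw [compare_lt_iff_lt, cross_anticomm]
        exact ⟨by linarith, h2⟩)
    (by rw [x2]; exact hlen)
  rw [List.append_nil] at m4
  have hMmem : ∀ k, k ∈ M ↔ q' ∈ (s k).points ∧ toLex q' < toLex (s k).hi := fun k =>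
    m4.mem_iff.trans (hmemnew k)
  obtain ⟨t1, t2, t3, t4, t5⟩ := hstep M (m4.nodup_iff.2 hnewnd) hMmem m3 _ rfl
  rw [← m1] at t1 t2 t3 t4 t5
  set T' := AVL.insertAll (statusCmp s q') new R.val.2 with hT'
  -- scheduling
  have hlo : ∀ k ∈ T'.val.toList, toLex (s k).lo ≤ toLex q' := fun k hk => ((t2 k).1 hk).1
  have hT'eq : T'.val.toList = A ++ M ++ C := m1
  have hloA : ∀ k ∈ A, toLex (s k).lo ≤ toLex q' := fun k hk => hlo k (by simp [hT'eq, hk])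
  have hloC : ∀ k ∈ C, toLex (s k).lo ≤ toLex q' := fun k hk => hlo k (by simp [hT'eq, hk])
  have hloM : ∀ k ∈ new, toLex (s k).lo ≤ toLex q' := fun k hk =>
    hlo k (by simp [hT'eq, m4.mem_iff.2 hk])
  set S := scheduleNeighbours s q' A.getLast? C.head? new Q' with hS
  obtain ⟨s1, s2, s3, s4, s5, s6⟩ := scheduleNeighbours_spec hs hQinv
    (below := A.getLast?) (above := C.head?) (new := new)
    (fun j hj => hloA j (List.mem_of_getLast? hj)) (fun j hj => hloC j (List.mem_of_head? hj))
    hloM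
    (by
      rintro j hj k hk rfl
      have h1 := ((hmemA j).1 (List.mem_of_getLast? hj)).2
      have h2 := ((hmemC j).1 (List.mem_of_head? hk)).2
      simp [h1] at h2)
    (fun j hj => hACn j (by simp [List.mem_of_getLast? hj]))
    (fun j hj => hACn j (by simp [List.mem_of_head? hj])) hS
  have hval : r.val = ⟨R.val.1 ++ start, S.val, T'.val⟩ := by
    rw [hr, handle_eq, hS, hT', ← hbelow, ← habove, hnew, ← survivors_val, ← append_val]
    rfl
  have htime : r.time ≤ R.time + (R.val.2.height + 1) + (R.val.2.height + 1) +
      (R.val.1.length + 1) + T'.time + S.time + (R.val.1.length + 1) + 1 := by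
    have : r.time = R.time + ((R.val.2.findBefore (fun k => step ((s k).side q')) none).time +
        ((R.val.2.findAfter (fun k => step ((s k).side q')) none).time +
        ((survivors s q' R.val.1 start).time + (T'.time + (S.time +
        ((append R.val.1 start).time + 1)))))) := by
      rw [hr, handle_eq, hS, hT', ← hbelow, ← habove, hnew, ← survivors_val]
      rfl
    rw [this, survivors_time, append_time]
    omega
  rw [hval]
  simp only
  refine ⟨⟨s1, m2, t1, t2, t3, ?_⟩, ⟨?_, ?_⟩, B.length, M.length, ?_, t4, t5, ?_⟩
  · -- the pairs of neighbours in the new status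
    have hadj := h.adjacent
    rw [hTeq] at hadj
    have hold : ∀ j k, (∀ v ∈ (s j).points, v ∈ (s k).points → toLex q < toLex v → v ∈ keys Q) →
        ∀ v ∈ (s j).points, v ∈ (s k).points → toLex q' < toLex v → v ∈ keys S.val :=
      fun j k hjk v hv hv' hlt => s2 (hmemQ v (hjk v hv hv' (hq.lt.trans hlt)) hlt)
    have hcA := hadj.left_of_append.left_of_append.imp hold
    have hcC := hadj.right_of_append.imp hold
    have hcM : M.IsChain fun j k =>
        ∀ v ∈ (s j).points, v ∈ (s k).points → toLex q' < toLex v → v ∈ keys S.val := by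
      refine List.Pairwise.isChain (List.Pairwise.imp_of_mem ?_ (m4.nodup_iff.2 hnewnd))
      intro j k hj hk hjk v hv hv' hlt
      have := hs.eq_of_mem hjk hv hv' ((hMmem j).1 hj).1 ((hMmem k).1 hk).1
      exact absurd (congrArg toLex this) hlt.ne'
    rw [hT'eq]
    by_cases hM : M = []
    · have hn0 : new = [] := by
        rw [hM] at m4
        exact m4.symm.eq_nil
      rw [hM, List.append_nil]
      exact List.isChain_append.2 ⟨hcA, hcC, s3 hn0⟩
    · rw [List.append_assoc]
      refine List.isChain_append.2 ⟨hcA, List.isChain_append.2 ⟨hcM, hcC, ?_⟩, ?_⟩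
      · intro j hj k hk v hv hv'
        exact s5 k hk j (m4.mem_iff.1 (List.mem_of_getLast? hj)) v hv' hv
      · intro j hj k hk
        rw [List.head?_append_of_ne_nil _ hM] at hk
        exact s4 j hj k (m4.mem_iff.1 (List.mem_of_head? hk))
  · exact List.nodup_append'.2 ⟨hBnd, hstnd, fun k hk hk' => hdisj k hk hk'⟩
  · intro k
    rw [List.mem_append, hmemR, hst, h.mem_points_iff_status hs hq k]
  · have h1 : start.length ≤ new.length := by simp [hnew]
    rw [List.length_append, x1.length_eq, m4.length_eq]
    omega
  · have e1 := x1.length_eq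
    have e2 := m4.length_eq
    have m5' : T'.time ≤ M.length * (2 * heightBound n + 1) + 1 := by rw [e2]; exact m5
    rw [← e2] at s6
    rw [e1] at htime
    have f1 : (B.length + 1) * (2 * heightBound n + 2) ≤ (B.length + 1) * (4 * H) :=
      Nat.mul_le_mul_left _ (by omega)
    have f2 : M.length * (2 * heightBound n + 1) ≤ M.length * (4 * H) :=
      Nat.mul_le_mul_left _ (by omega)
    have f3 : (2 * M.length + 1) * (2 * heightBound (vertices s).ncard + 2) ≤
        (2 * M.length + 1) * (4 * H) := Nat.mul_le_mul_left _ (by omega)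
    have f4 : B.length ≤ B.length * H := Nat.le_mul_of_pos_right _ hH1
    have f5 : 27 * H * (B.length + M.length + 1) =
      27 * (B.length * H) + 27 * (M.length * H) + 27 * H := by ring
    have f6 : (B.length + 1) * (4 * H) = 4 * (B.length * H) + 4 * H := by ring
    have f7 : M.length * (4 * H) = 4 * (M.length * H) := by ring
    have f8 : (2 * M.length + 1) * (4 * H) = 8 * (M.length * H) + 4 * H := by ring
    rw [f6] at f1
    rw [f7] at f2
    rw [f8] at f3
    rw [f5]
    omega

/-! ### The plane sweep -/

/-- The number of the vertices after `q`. -/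
noncomputable def remaining (s : Fin n → Segment ℝ) (q : ℝ × ℝ) : ℕ :=
  {v | v ∈ vertices s ∧ toLex q < toLex v}.ncard

theorem remaining_step (hs : Admissible s) {q q' : ℝ × ℝ} (hq : NextVertex s q q') :
    remaining s q = remaining s q' + 1 := by
  have h1 : {v | v ∈ vertices s ∧ toLex q < toLex v} =
      insert q' {v | v ∈ vertices s ∧ toLex q' < toLex v} := by
    ext v
    simp only [Set.mem_ofPred_eq, Set.mem_insert_iff]
    constructor
    · rintro ⟨hv, hqv⟩
      rcases (hq.le v hv hqv).eq_or_lt with h | h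
      · exact Or.inl (by simpa using h.symm)
      · exact Or.inr ⟨hv, h⟩
    · rintro (rfl | ⟨hv, h⟩)
      · exact ⟨hq.vertex, hq.lt⟩
      · exact ⟨hv, hq.lt.trans h⟩
  rw [remaining, remaining, h1, Set.ncard_insert_of_notMem (fun h => lt_irrefl _ h.2)
    (hs.vertices_finite.1.subset fun _ h => h.1)]

theorem remaining_eq_zero (hs : Admissible s) {q : ℝ × ℝ} :
    remaining s q = 0 ↔ ∀ v ∈ vertices s, ¬ toLex q < toLex v := by
  rw [remaining, Set.ncard_eq_zero (hs.vertices_finite.1.subset fun _ h => h.1),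
    Set.eq_empty_iff_forall_notMem]
  simp

/-- The list of the vertices after `q` in lexicographic order, each with the segments through it. -/
structure IsVertexList (s : Fin n → Segment ℝ) (q : ℝ × ℝ)
    (A : List ((ℝ × ℝ) × List (Fin n))) : Prop where
  sorted : A.Pairwise fun e f => toLex e.1 < toLex f.1
  mem_iff : ∀ v, v ∈ A.map Prod.fst ↔ v ∈ vertices s ∧ toLex q < toLex v
  through : ∀ e ∈ A, e.2.Nodup ∧ ∀ k, k ∈ e.2 ↔ e.1 ∈ (s k).points

/-- The total length of the lists of segments through the vertices. -/
def totalLength (A : List ((ℝ × ℝ) × List (Fin n))) : ℕ := (A.map fun e => e.2.length).sum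

/-- Twice the number of crossed neighbours pays for the segments that are inserted into and removed
from the status. -/
theorem sweep_spec (hs : Admissible s) {H : ℕ} (hH1 : 1 ≤ H) (hHn : heightBound n ≤ H)
    (hHp : heightBound (vertices s).ncard ≤ H) (fuel : ℕ) :
    ∀ (q : ℝ × ℝ) (Q : AVL ((ℝ × ℝ) × List (Fin n))) (T : AVL (Fin n)), SweepInv s q Q T →
      remaining s q ≤ fuel →
      IsVertexList s q (sweep s fuel Q T).val ∧
      totalLength (sweep s fuel Q T).val + 2 * crossed s q T.toList ≤
        T.toList.length + 6 * remaining s q ∧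
      (sweep s fuel Q T).time + 30 * H * (2 * crossed s q T.toList) ≤
        30 * H * (T.toList.length + 7 * remaining s q + 1) := by
  have hend : ∀ (q : ℝ × ℝ) (Q : AVL ((ℝ × ℝ) × List (Fin n))) (T : AVL (Fin n)),
      SweepInv s q Q T → remaining s q = 0 → IsVertexList s q [] ∧ T.toList = [] := by
    intro q Q T h h0
    rw [remaining_eq_zero hs] at h0
    refine ⟨⟨List.Pairwise.nil, fun v => ?_, by simp⟩, ?_⟩
    · simp only [List.map_nil, List.not_mem_nil, false_iff, not_and]
      exact h0 v
    · exact List.eq_nil_iff_forall_not_mem.2 fun k hk =>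
        h0 _ (hi_mem_vertices s k) ((h.mem_status k).1 hk).2
  induction fuel with
  | zero =>
    intro q Q T h hf
    obtain ⟨h1, h2⟩ := hend q Q T h (by omega)
    refine ⟨by simpa [sweep] using h1, by simp [sweep, h2, totalLength, crossed], ?_⟩
    simp only [sweep, step_time, h2, crossed, adjCount_nil, List.length_nil]
    nlinarith
  | succ fuel ih =>
    intro q Q T h hf
    have hpop := popMin_time_le h.bal
    have hheight := h.bal.height_le (h.toQueueInv.length_le hs)
    simp only [sweep, Timed.bind_val, Timed.bind_time]
    rcases popMin_toList Q with ⟨h1, h2⟩ | ⟨e, Q', h1, h2⟩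
    · have h0 : remaining s q = 0 := by
        rw [remaining_eq_zero hs]
        intro v hv hqv
        obtain ⟨q', hq'⟩ := exists_nextVertex hs hv hqv
        simpa [keys, h2] using h.next_mem_keys hs hq'
      obtain ⟨h3, h4⟩ := hend q Q T h h0
      simp only [h1, step_val, step_time, h4, h0]
      refine ⟨h3, by simp [totalLength, crossed], ?_⟩
      simp only [crossed, adjCount_nil, List.length_nil]
      omega
    · have hq := h.nextVertex_head hs h2
      have hrem := remaining_step hs hq
      obtain ⟨i1, ⟨i2, i3⟩, b, m, i4, i5, i6, i7⟩ := handle_spec hs h (popMin_bal h.bal h1).1 h2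
        hH1 hHn hHp rfl
      obtain ⟨r1, r2, r3⟩ := ih _ _ _ i1 (by omega)
      simp only [h1, Timed.bind_val, Timed.bind_time, step_val, step_time]
      set R := sweep s fuel (handle s e.1 e.2 Q' T).val.queue (handle s e.1 e.2 Q' T).val.status
      refine ⟨⟨List.pairwise_cons.2 ⟨?_, r1.sorted⟩, ?_, ?_⟩, ?_, ?_⟩
      · intro f hf
        exact ((r1.mem_iff f.1).1 (List.mem_map_of_mem hf)).2
      · intro v
        rw [List.map_cons, List.mem_cons, r1.mem_iff]
        constructor
        · rintro (rfl | ⟨hv, h⟩)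
          · exact ⟨hq.vertex, hq.lt⟩
          · exact ⟨hv, hq.lt.trans h⟩
        · rintro ⟨hv, hqv⟩
          rcases (hq.le v hv hqv).eq_or_lt with h | h
          · exact Or.inl (by simpa using h.symm)
          · exact Or.inr ⟨hv, h⟩
      · intro f hf
        rcases List.mem_cons.1 hf with rfl | hf
        · exact ⟨i2, i3⟩
        · exact r1.through f hf
      · simp only [totalLength, List.map_cons, List.sum_cons] at r2 ⊢
        omega
      · have f1 : b + m + 1 + ((handle s e.1 e.2 Q' T).val.status.toList.length +
            7 * remaining s e.1 + 1) + 2 * crossed s q T.toList ≤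
            2 * crossed s e.1 (handle s e.1 e.2 Q' T).val.status.toList +
              (T.toList.length + 7 * remaining s q + 1) := by omega
        have f2 := Nat.mul_le_mul_left (30 * H) f1
        simp only [Nat.mul_add] at f2 r3 i7 ⊢
        have f3 : 27 * H * b ≤ 30 * H * b := Nat.mul_le_mul_right _ (by omega)
        have f4 : 27 * H * m ≤ 30 * H * m := Nat.mul_le_mul_right _ (by omega)
        omega

/-- The plane sweep lists all vertices with the segments through them; these lists have linear
total length, and it takes `O((n + p) log p)` steps. -/
theorem procedureA_spec (hs : Admissible s) {H : ℕ} (hH1 : 1 ≤ H) (hHn : heightBound n ≤ H)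
    (hHp : heightBound (vertices s).ncard ≤ H) :
    (∃ q, (∀ v ∈ vertices s, toLex q < toLex v) ∧ IsVertexList s q (procedureA s).val) ∧
    totalLength (procedureA s).val ≤ 6 * (vertices s).ncard ∧
    (procedureA s).time ≤ 6 * H * n + 210 * H * (vertices s).ncard + 31 * H := by
  obtain ⟨q, hq⟩ : ∃ q : ℝ × ℝ, ∀ v ∈ vertices s, toLex q < toLex v := by
    obtain ⟨x, hx⟩ := (hs.vertices_finite.1.image Prod.fst).bddBelow
    refine ⟨(x - 1, 0), fun v hv => ?_⟩
    rw [Prod.Lex.toLex_lt_toLex]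
    have := hx (Set.mem_image_of_mem _ hv)
    exact Or.inl (by simp only; linarith)
  have hrem : remaining s q = (vertices s).ncard := by
    rw [remaining]
    congr 1
    ext v
    exact ⟨fun h => h.1, fun h => ⟨h, hq v h⟩⟩
  obtain ⟨h1, h2⟩ := initQueue_spec hs (List.finRange n) (fun _ => False) AVL.nil
    ⟨trivial, List.Pairwise.nil, by simp [keys], by simp⟩ (List.nodup_finRange n) (by simp)
  have hinv : SweepInv s q (initQueue s (List.finRange n) AVL.nil).val AVL.nil :=
    { bal := h1.bal
      sorted := h1.sorted
      vertex := by
        intro v hv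
        obtain ⟨k, -, rfl | rfl⟩ := (h1.mem_keys v).1 hv
        · exact ⟨lo_mem_vertices s k, hq _ (lo_mem_vertices s k)⟩
        · exact ⟨hi_mem_vertices s k, hq _ (hi_mem_vertices s k)⟩
      starts := fun e he => ⟨(h1.starts e he).1, fun k => by simp [(h1.starts e he).2 k]⟩
      lo_mem := fun k _ => (h1.mem_keys _).2 ⟨k, by simp, Or.inl rfl⟩
      hi_mem := fun k _ => (h1.mem_keys _).2 ⟨k, by simp, Or.inr rfl⟩
      status_bal := trivial
      status_nodup := List.nodup_nil
      mem_status := by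
        intro k
        simp only [toList_nil, List.not_mem_nil, false_iff, not_and]
        exact fun h => absurd (hq _ (lo_mem_vertices s k)) h.not_gt
      below := List.Pairwise.nil
      adjacent := List.IsChain.nil }
  obtain ⟨r1, r2, r3⟩ := sweep_spec hs hH1 hHn hHp (n * n + 2 * n) q _ _ hinv
    (hrem ▸ hs.vertices_finite.2)
  rw [hrem] at r2 r3
  refine ⟨⟨q, hq, by simpa [procedureA] using r1⟩, ?_, ?_⟩
  · simpa [procedureA, crossed] using r2
  · simp only [procedureA, Timed.bind_time]
    simp only [crossed, toList_nil, adjCount_nil, List.length_nil, List.length_finRange] at r3 h2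
    have f1 : n * (2 * (2 * heightBound (vertices s).ncard + 1)) ≤ n * (6 * H) :=
      Nat.mul_le_mul_left _ (by omega)
    have f2 : n * (6 * H) = 6 * H * n := by ring
    have f3 : 30 * H * (0 + 7 * (vertices s).ncard + 1) =
      210 * H * (vertices s).ncard + 30 * H := by ring
    omega

/-- Every segment is in the list of its first end point. -/
theorem IsVertexList.card_le {q : ℝ × ℝ} {A : List ((ℝ × ℝ) × List (Fin n))}
    (hA : IsVertexList s q A) (hq : ∀ v ∈ vertices s, toLex q < toLex v) : n ≤ totalLength A := by
  classical
  have h1 : (Finset.univ : Finset (Fin n)) ⊆ (A.flatMap Prod.snd).toFinset := by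
    intro k _
    obtain ⟨e, he, hk⟩ := List.mem_map.1
      ((hA.mem_iff _).2 ⟨lo_mem_vertices s k, hq _ (lo_mem_vertices s k)⟩)
    rw [List.mem_toFinset, List.mem_flatMap]
    exact ⟨e, he, ((hA.through e he).2 k).2 (hk ▸ (s k).lo_mem)⟩
  calc n = (Finset.univ : Finset (Fin n)).card := by simp
    _ ≤ (A.flatMap Prod.snd).toFinset.card := Finset.card_le_card h1
    _ ≤ (A.flatMap Prod.snd).length := List.toFinset_card_le _
    _ = totalLength A := by rw [List.length_flatMap, totalLength]

/-! ### Lists of vertices along the segments -/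

theorem addEntry_map (j : ℕ) (v : ℝ × ℝ) (k : Fin n) (L : Fin n → List (Entry ℝ)) (i : Fin n) :
    (addEntry j v k L i).map Entry.v =
      if i = k then v :: (L i).map Entry.v else (L i).map Entry.v := by
  unfold addEntry
  by_cases h : i = k
  · subst h
    rw [Function.update_self, if_pos rfl]
    cases L i <;> simp
  · rw [Function.update_of_ne h, if_neg h]

theorem readVertex_spec (j : ℕ) (v : ℝ × ℝ) (ks : List (Fin n)) (hks : ks.Nodup)
    (L : Fin n → List (Entry ℝ)) :
    (∀ i, ((readVertex j v ks L).val i).map Entry.v =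
      if i ∈ ks then v :: (L i).map Entry.v else (L i).map Entry.v) ∧
    (readVertex j v ks L).time = ks.length + 1 := by
  induction ks generalizing L with
  | nil => simp [readVertex]
  | cons k ks ih =>
    obtain ⟨hk, hks⟩ := List.nodup_cons.1 hks
    obtain ⟨h1, h2⟩ := ih hks (addEntry j v k L)
    simp only [readVertex, Timed.bind_val, Timed.bind_time, step_val, step_time]
    refine ⟨fun i => ?_, by simp only [h2, List.length_cons]; omega⟩
    rw [h1, addEntry_map]
    by_cases hi : i = k
    · subst hi
      simp [hk]
    · simp [hi]

theorem readAll_spec (A : List ((ℝ × ℝ) × List (Fin n))) (hA : ∀ e ∈ A, e.2.Nodup) (j : ℕ)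
    (L : Fin n → List (Entry ℝ)) :
    (∀ i, ((readAll j A L).val i).map Entry.v =
      ((A.filter fun e => i ∈ e.2).map Prod.fst).reverse ++ (L i).map Entry.v) ∧
    (readAll j A L).time = totalLength A + A.length + 1 := by
  induction A generalizing j L with
  | nil => simp [readAll, totalLength]
  | cons e A ih =>
    obtain ⟨v, ks⟩ := e
    obtain ⟨h1, h2⟩ := readVertex_spec j v ks (hA _ List.mem_cons_self) L
    obtain ⟨h3, h4⟩ := ih (fun e he => hA e (List.mem_cons_of_mem _ he)) (j + 1)
      (readVertex j v ks L).val
    simp only [readAll, Timed.bind_val, Timed.bind_time]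
    refine ⟨fun i => ?_, ?_⟩
    · rw [h3, h1]
      by_cases hi : i ∈ ks <;> simp [hi]
    · simp only [h4, h2, totalLength, List.map_cons, List.sum_cons, List.length_cons]
      omega

theorem sum_length_filter (A : List ((ℝ × ℝ) × List (Fin n))) (hA : ∀ e ∈ A, e.2.Nodup) :
    ∑ i, (A.filter fun e => i ∈ e.2).length = totalLength A := by
  induction A with
  | nil => simp [totalLength]
  | cons e A ih =>
    have h1 : ∀ i : Fin n, ((e :: A).filter fun e => i ∈ e.2).length =
        (if i ∈ e.2 then 1 else 0) + (A.filter fun e => i ∈ e.2).length := by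
      intro i
      by_cases hi : i ∈ e.2 <;> simp [hi, add_comm]
    simp only [h1, Finset.sum_add_distrib, ih fun e he => hA e (List.mem_cons_of_mem _ he)]
    have h2 : ∑ i : Fin n, (if i ∈ e.2 then 1 else 0) = e.2.length := by
      rw [← List.toFinset_card_of_nodup (hA e List.mem_cons_self), Finset.card_eq_sum_ones,
        ← Finset.sum_filter]
      congr 1
      ext i
      simp
    rw [h2, totalLength, totalLength, List.map_cons, List.sum_cons]

/-- The position of a point along a segment, up to an affine change of scale. -/
def Segment.along (S : Segment ℝ) (u : ℝ × ℝ) : ℝ := (S.b - S.a).1 * u.1 + (S.b - S.a).2 * u.2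

theorem sortAll_spec (s : Fin n → Segment ℝ) (N : ℕ) (ks : List (Fin n)) (hks : ks.Nodup)
    (L : Fin n → List (Entry ℝ))
    (hL : ∀ k ∈ ks, (L k).length ≤ N ∧ (L k).Nodup ∧
      ∀ e ∈ L k, ∀ f ∈ L k, e ≠ f → (s k).along e.v ≠ (s k).along f.v) :
    (∀ k, k ∉ ks → (sortAll s ks L).val k = L k) ∧
    (∀ k ∈ ks, ((sortAll s ks L).val k).Pairwise (fun e f => (s k).along e.v < (s k).along f.v) ∧
      ((sortAll s ks L).val k).Perm (L k)) ∧
    (sortAll s ks L).time ≤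
      (ks.map fun k => (L k).length * (2 * heightBound N + 2) + 3).sum + 1 := by
  induction ks generalizing L with
  | nil => simp [sortAll]
  | cons k ks ih =>
    obtain ⟨hk, hks⟩ := List.nodup_cons.1 hks
    obtain ⟨l1, l2, l3⟩ := hL k List.mem_cons_self
    obtain ⟨s1, s2, s3⟩ := sort_spec (fun e f : Entry ℝ => (s k).alongCmp e.v f.v)
      (fun e f => (s k).along e.v < (s k).along f.v) (fun e => lt_irrefl _)
      (fun e f g => lt_trans) (L k) l2 (fun e he f hf hef => by
        rcases lt_or_gt_of_ne (l3 e he f hf hef) with h | h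
        · exact Or.inr ⟨compare_lt_iff_lt.2 h, h⟩
        · exact Or.inl ⟨compare_gt_iff_gt.2 h, h⟩) l1
    simp only [sortAll, Timed.bind_val, Timed.bind_time, step_val, step_time]
    set l := sort (fun e f : Entry ℝ => step ((s k).alongCmp e.v f.v)) (L k)
    have hupd : ∀ i ∈ ks, Function.update L k l.val i = L i := fun i hi =>
      Function.update_of_ne (by rintro rfl; exact hk hi) _ _
    obtain ⟨r1, r2, r3⟩ := ih hks (Function.update L k l.val) (fun i hi => by
      rw [hupd i hi]
      exact hL i (List.mem_cons_of_mem _ hi))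
    refine ⟨fun i hi => ?_, fun i hi => ?_, ?_⟩
    · rw [List.mem_cons, not_or] at hi
      rw [r1 i hi.2, Function.update_of_ne hi.1]
    · rcases List.mem_cons.1 hi with rfl | hi
      · rw [r1 i hk, Function.update_self]
        exact ⟨s1, s2⟩
      · rw [← hupd i hi]
        exact r2 i hi
    · have h1 : (ks.map fun i => (Function.update L k l.val i).length *
          (2 * heightBound N + 2) + 3) =
          ks.map fun i => (L i).length * (2 * heightBound N + 2) + 3 :=
        List.map_congr_left fun i hi => by rw [hupd i hi]
      rw [h1] at r3
      rw [List.map_cons, List.sum_cons]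
      omega

theorem consecutive_spec (l : List (Entry ℝ)) :
    (consecutive l).val = (l.map Entry.v).zip (l.map Entry.v).tail ∧
      (consecutive l).time ≤ l.length + 1 := by
  induction l with
  | nil => simp [consecutive]
  | cons e l ih =>
    cases l with
    | nil => simp [consecutive]
    | cons f l =>
      obtain ⟨h1, h2⟩ := ih
      simp only [consecutive, Timed.bind_val, Timed.bind_time, step_val, step_time, h1]
      refine ⟨by simp, ?_⟩
      simp only [List.length_cons] at h2 ⊢
      omega

theorem edgesAll_spec (L : Fin n → List (Entry ℝ)) (ks : List (Fin n)) (hks : ks.Nodup)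
    (E : Fin n → List ((ℝ × ℝ) × (ℝ × ℝ))) :
    (∀ k, k ∉ ks → (edgesAll L ks E).val k = E k) ∧
    (∀ k ∈ ks, (edgesAll L ks E).val k =
      ((L k).map Entry.v).zip ((L k).map Entry.v).tail) ∧
    (edgesAll L ks E).time ≤ (ks.map fun k => (L k).length + 2).sum + 1 := by
  induction ks generalizing E with
  | nil => simp [edgesAll]
  | cons k ks ih =>
    obtain ⟨hk, hks⟩ := List.nodup_cons.1 hks
    obtain ⟨c1, c2⟩ := consecutive_spec (L k)
    obtain ⟨r1, r2, r3⟩ := ih hks (Function.update E k (consecutive (L k)).val)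
    simp only [edgesAll, Timed.bind_val, Timed.bind_time, step_val, step_time]
    refine ⟨fun i hi => ?_, fun i hi => ?_, ?_⟩
    · rw [List.mem_cons, not_or] at hi
      rw [r1 i hi.2, Function.update_of_ne hi.1]
    · rcases List.mem_cons.1 hi with rfl | hi
      · rw [r1 i hk, Function.update_self, c1]
      · exact r2 i hi
    · rw [List.map_cons, List.sum_cons]
      omega

/-! ### The edges on a segment -/

namespace Segment

variable {S : Segment ℝ}

theorem points_eq_image (S : Segment ℝ) :
    S.points = AffineMap.lineMap S.a S.b '' Set.Icc (0 : ℝ) 1 :=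
  segment_eq_image_lineMap ℝ S.a S.b

/-- Positions along a segment are a strictly increasing function of the affine parameter. -/
theorem along_lineMap (hS : S.a ≠ S.b) {x y : ℝ} :
    S.along (AffineMap.lineMap S.a S.b x) < S.along (AffineMap.lineMap S.a S.b y) ↔ x < y := by
  have hD : 0 < (S.b.1 - S.a.1) ^ 2 + (S.b.2 - S.a.2) ^ 2 := by
    by_contra! h
    apply hS
    have e1 := sq_nonneg (S.b.1 - S.a.1)
    have e2 := sq_nonneg (S.b.2 - S.a.2)
    have h1 : (S.b.1 - S.a.1) ^ 2 = 0 := by linarith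
    have h2 : (S.b.2 - S.a.2) ^ 2 = 0 := by linarith
    rw [sq_eq_zero_iff, sub_eq_zero] at h1 h2
    exact Prod.ext h1.symm h2.symm
  have key : S.along (AffineMap.lineMap S.a S.b y) - S.along (AffineMap.lineMap S.a S.b x) =
      (y - x) * ((S.b.1 - S.a.1) ^ 2 + (S.b.2 - S.a.2) ^ 2) := by
    simp only [along, AffineMap.lineMap_apply, vsub_eq_sub, vadd_eq_add, Prod.fst_add, Prod.snd_add,
      Prod.smul_fst, Prod.smul_snd, Prod.fst_sub, Prod.snd_sub, smul_eq_mul]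
    ring
  rw [← sub_pos, key, mul_pos_iff_of_pos_right hD, sub_pos]

theorem eq_of_along_eq (hS : S.a ≠ S.b) {u v : ℝ × ℝ} (hu : u ∈ S.points) (hv : v ∈ S.points)
    (h : S.along u = S.along v) : u = v := by
  rw [points_eq_image] at hu hv
  obtain ⟨x, -, rfl⟩ := hu
  obtain ⟨y, -, rfl⟩ := hv
  rcases lt_trichotomy x y with hxy | rfl | hxy
  · exact absurd h ((along_lineMap hS).2 hxy).ne
  · rfl
  · exact absurd h ((along_lineMap hS).2 hxy).ne'

theorem mem_segment_iff (hS : S.a ≠ S.b) {u v w : ℝ × ℝ} (hu : u ∈ S.points) (hv : v ∈ S.points)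
    (huv : S.along u ≤ S.along v) :
    w ∈ segment ℝ u v ↔ w ∈ S.points ∧ S.along u ≤ S.along w ∧ S.along w ≤ S.along v := by
  rw [points_eq_image] at *
  obtain ⟨x, hx, rfl⟩ := hu
  obtain ⟨y, hy, rfl⟩ := hv
  have hxy : x ≤ y := not_lt.1 fun h => huv.not_gt ((along_lineMap hS).2 h)
  rw [← image_segment, segment_eq_Icc hxy]
  constructor
  · rintro ⟨z, hz, rfl⟩
    exact ⟨⟨z, ⟨hx.1.trans hz.1, hz.2.trans hy.2⟩, rfl⟩,
      not_lt.1 fun h => hz.1.not_gt ((along_lineMap hS).1 h),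
      not_lt.1 fun h => hz.2.not_gt ((along_lineMap hS).1 h)⟩
  · rintro ⟨⟨z, hz, rfl⟩, h1, h2⟩
    exact ⟨z, ⟨not_lt.1 fun h => h1.not_gt ((along_lineMap hS).2 h),
      not_lt.1 fun h => h2.not_gt ((along_lineMap hS).2 h)⟩, rfl⟩

theorem mem_openSegment_iff (hS : S.a ≠ S.b) {u v w : ℝ × ℝ} (hu : u ∈ S.points)
    (hv : v ∈ S.points) (huv : S.along u < S.along v) :
    w ∈ openSegment ℝ u v ↔ w ∈ S.points ∧ S.along u < S.along w ∧ S.along w < S.along v := by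
  rw [points_eq_image] at *
  obtain ⟨x, hx, rfl⟩ := hu
  obtain ⟨y, hy, rfl⟩ := hv
  have hxy : x < y := (along_lineMap hS).1 huv
  rw [← image_openSegment, openSegment_eq_Ioo hxy]
  constructor
  · rintro ⟨z, hz, rfl⟩
    exact ⟨⟨z, ⟨hx.1.trans hz.1.le, hz.2.le.trans hy.2⟩, rfl⟩,
      (along_lineMap hS).2 hz.1, (along_lineMap hS).2 hz.2⟩
  · rintro ⟨⟨z, hz, rfl⟩, h1, h2⟩
    exact ⟨z, ⟨(along_lineMap hS).1 h1, (along_lineMap hS).1 h2⟩, rfl⟩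

theorem along_a_le (hS : S.a ≠ S.b) {u : ℝ × ℝ} (hu : u ∈ S.points) :
    S.along S.a ≤ S.along u := by
  rw [points_eq_image] at hu
  obtain ⟨x, hx, rfl⟩ := hu
  have h := along_lineMap hS (x := x) (y := 0)
  rw [AffineMap.lineMap_apply_zero] at h
  exact not_lt.1 fun h' => hx.1.not_gt (h.1 h')

end Segment

theorem mem_zip_tail_iff {α : Type} {l : List α} {u v : α} :
    (u, v) ∈ l.zip l.tail ↔ ∃ l₁ l₂, l = l₁ ++ u :: v :: l₂ := by
  induction l with
  | nil => simp
  | cons a l ih =>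
    cases l with
    | nil =>
      simp only [List.tail_cons, List.zip_nil_right, List.not_mem_nil, false_iff, not_exists]
      rintro l₁ l₂ h
      have := congrArg List.length h
      simp at this
      omega
    | cons b l =>
      simp only [List.tail_cons, List.zip_cons_cons, List.mem_cons, Prod.mk.injEq] at ih ⊢
      rw [ih]
      constructor
      · rintro (⟨rfl, rfl⟩ | ⟨l₁, l₂, h⟩)
        · exact ⟨[], l, rfl⟩
        · exact ⟨a :: l₁, l₂, by rw [h]; rfl⟩
      · rintro ⟨_ | ⟨c, l₁⟩, l₂, h⟩
        · simp only [List.nil_append, List.cons.injEq] at h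
          exact Or.inl ⟨h.1.symm, h.2.1.symm⟩
        · simp only [List.cons_append, List.cons.injEq] at h
          exact Or.inr ⟨l₁, l₂, h.2⟩

theorem pairwise_zip_tail {α : Type} (f : α → ℝ) {l : List α}
    (hl : l.Pairwise fun u v => f u < f v) :
    (l.zip l.tail).Pairwise fun p p' => f p.2 ≤ f p'.1 := by
  induction l with
  | nil => simp
  | cons a l ih =>
    cases l with
    | nil => simp
    | cons b l =>
      have h := (List.pairwise_cons.1 hl).2
      simp only [List.tail_cons, List.zip_cons_cons] at ih ⊢
      refine List.pairwise_cons.2 ⟨?_, ih h⟩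
      rintro ⟨u, v⟩ hp
      rcases List.mem_cons.1 (List.of_mem_zip hp).1 with rfl | hu
      · exact le_rfl
      · exact ((List.pairwise_cons.1 h).1 u hu).le

/-- The pairs of consecutive vertices on a segment are its edges. -/
theorem isOrderedEdgeList_zip_tail (hs : Admissible s) (k : Fin n) {l : List (ℝ × ℝ)}
    (hmem : ∀ v, v ∈ l ↔ v ∈ vertices s ∧ v ∈ (s k).points)
    (hl : l.Pairwise fun u v => (s k).along u < (s k).along v) :
    IsOrderedEdgeList s k (l.zip l.tail) := by
  have hk := hs.nondegenerate k
  have hlt : ∀ p ∈ l.zip l.tail, (s k).along p.1 < (s k).along p.2 := by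
    rintro ⟨u, v⟩ hp
    obtain ⟨l₁, l₂, rfl⟩ := mem_zip_tail_iff.1 hp
    exact (List.pairwise_cons.1 (List.pairwise_append.1 hl).2.1).1 v (by simp)
  have hpts : ∀ p ∈ l.zip l.tail, p.1 ∈ (s k).points ∧ p.2 ∈ (s k).points := fun p hp =>
    ⟨((hmem _).1 (List.of_mem_zip hp).1).2,
      ((hmem _).1 (List.mem_of_mem_tail (List.of_mem_zip hp).2)).2⟩
  have hzip := pairwise_zip_tail (s k).along hl
  -- an edge on the segment, directed along it, joins consecutive vertices
  have hedge : ∀ u v : vertices s, (planeGraph s).Adj u v → (u : ℝ × ℝ) ∈ (s k).points →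
      (v : ℝ × ℝ) ∈ (s k).points → (s k).along u < (s k).along v →
      ((u : ℝ × ℝ), (v : ℝ × ℝ)) ∈ l.zip l.tail := by
    intro u v hadj hu hv huv
    rw [mem_zip_tail_iff]
    obtain ⟨l₁, l₂, rfl⟩ := List.append_of_mem ((hmem u).2 ⟨u.2, hu⟩)
    have hvl := (hmem v).2 ⟨v.2, hv⟩
    obtain ⟨-, p2, p3⟩ := List.pairwise_append.1 hl
    have hv2 : (v : ℝ × ℝ) ∈ l₂ := by
      rcases List.mem_append.1 hvl with h | h
      · exact absurd (p3 v h u (by simp)) huv.not_gt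
      · rcases List.mem_cons.1 h with h | h
        · exact absurd huv (by rw [h]; exact lt_irrefl _)
        · exact h
    rcases l₂ with _ | ⟨w, l₃⟩
    · simp at hv2
    · rcases List.mem_cons.1 hv2 with h | h
      · exact ⟨l₁, l₃, by rw [h]⟩
      · exfalso
        have h1 := (List.pairwise_cons.1 p2).1 w (by simp)
        have h2 := (List.pairwise_cons.1 (List.pairwise_cons.1 p2).2).1 v h
        have hw := (hmem w).1 (by simp)
        exact Set.disjoint_left.1 hadj.2.2
          ((mem_openSegment_iff hk hu hv huv).2 ⟨hw.2, h1, h2⟩) hw.1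
  refine ⟨?_, ?_, ?_, ?_⟩
  · intro e
    rw [List.mem_map]
    constructor
    · rintro ⟨u, v, hadj, hsub, rfl⟩
      have hu := hsub (left_mem_segment ..)
      have hv := hsub (right_mem_segment ..)
      have hne : (s k).along u ≠ (s k).along v := fun h =>
        hadj.1 (Subtype.ext (eq_of_along_eq hk hu hv h))
      rcases lt_or_gt_of_ne hne with h | h
      · exact ⟨_, hedge u v hadj hu hv h, rfl⟩
      · exact ⟨_, hedge v u hadj.symm hv hu h, Sym2.eq_swap⟩
    · rintro ⟨⟨u, v⟩, hp, rfl⟩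
      have huv := hlt _ hp
      obtain ⟨hu, hv⟩ := hpts _ hp
      obtain ⟨l₁, l₂, rfl⟩ := mem_zip_tail_iff.1 hp
      simp only at huv hu hv ⊢
      have hu' := ((hmem u).1 (by simp)).1
      have hv' := ((hmem v).1 (by simp)).1
      have hsub : segment ℝ u v ⊆ (s k).points := fun w hw =>
        ((mem_segment_iff hk hu hv huv.le).1 hw).1
      refine ⟨⟨u, hu'⟩, ⟨v, hv'⟩, ⟨fun h => ?_, ?_, ?_⟩, hsub, rfl⟩
      · rw [Subtype.mk.injEq] at h
        exact huv.ne (by rw [h])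
      · exact hsub.trans (Set.subset_iUnion (fun k => (s k).points) k)
      · refine Set.disjoint_left.2 fun w hw hw' => ?_
        obtain ⟨h1, h2, h3⟩ := (mem_openSegment_iff hk hu hv huv).1 hw
        obtain ⟨-, p2, p3⟩ := List.pairwise_append.1 hl
        have hwl := (hmem w).2 ⟨hw', h1⟩
        simp only [List.mem_append, List.mem_cons] at hwl
        rcases hwl with h | rfl | rfl | h
        · exact (p3 w h u (by simp)).not_gt h2
        · exact lt_irrefl _ h2
        · exact lt_irrefl _ h3
        · exact ((List.pairwise_cons.1 (List.pairwise_cons.1 p2).2).1 w h).not_gt h3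
  · rw [List.Nodup, List.pairwise_map]
    refine List.Pairwise.imp_of_mem ?_ hzip
    rintro ⟨u, v⟩ ⟨u', v'⟩ hp hp' h heq
    have h1 := hlt _ hp
    have h2 := hlt _ hp'
    simp only [Sym2.eq_iff] at h1 h2 h heq
    rcases heq with ⟨rfl, rfl⟩ | ⟨rfl, rfl⟩ <;> linarith
  · intro p hp
    refine (mem_segment_iff hk (left_mem_segment ..) (hpts p hp).2
      (along_a_le hk (hpts p hp).2)).2 ⟨(hpts p hp).1, along_a_le hk (hpts p hp).1, (hlt p hp).le⟩
  · refine List.Pairwise.imp_of_mem ?_ hzip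
    intro p p' hp hp' h
    exact (mem_segment_iff hk (left_mem_segment ..) (hpts p' hp').1
      (along_a_le hk (hpts p' hp').1)).2 ⟨(hpts p hp).2, along_a_le hk (hpts p hp).2, h⟩

/-! ### Correctness and running time -/

theorem procedureB_spec (hs : Admissible s) {H : ℕ}
    (hH : heightBound (6 * (vertices s).ncard) ≤ H) (hp : 1 ≤ (vertices s).ncard) :
    (∀ k, IsOrderedEdgeList s k ((procedureB s).val k)) ∧
      (procedureB s).time ≤ 400 * (H * (vertices s).ncard) := by
  have hH1 : 1 ≤ H := le_trans (by unfold heightBound; omega) hH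
  have hHp : heightBound (vertices s).ncard ≤ H := (heightBound_mono (by omega)).trans hH
  set p := (vertices s).ncard with hpdef
  -- the linear bound for the number of segments holds for any bound on the heights
  have hn : n ≤ 6 * p := by
    obtain ⟨⟨q, hq, hA⟩, hW, -⟩ := procedureA_spec hs
      (H := max 1 (max (heightBound n) (heightBound p))) (le_max_left _ _)
      ((le_max_left _ _).trans (le_max_right _ _)) ((le_max_right _ _).trans (le_max_right _ _))
    exact (hA.card_le hq).trans hW
  obtain ⟨⟨q, hq, hA⟩, hW, htA⟩ := procedureA_spec hs hH1 ((heightBound_mono hn).trans hH) hHp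
  set A := (procedureA s).val with hAdef
  have hAnd : ∀ e ∈ A, e.2.Nodup := fun e he => (hA.through e he).1
  obtain ⟨r1, r2⟩ := readAll_spec A hAnd 1 (fun _ => ([] : List (Entry ℝ)))
  set L := readAll 1 A (fun _ => ([] : List (Entry ℝ))) with hL
  simp only [List.map_nil, List.append_nil] at r1
  have hkeysnd : (A.map Prod.fst).Nodup := by
    rw [List.Nodup, List.pairwise_map]
    exact hA.sorted.imp fun h h' => h.ne (congrArg toLex h')
  have hAlen : A.length ≤ p := by
    classical
    calc A.length = (A.map Prod.fst).length := by simp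
      _ = ((A.map Prod.fst).toFinset : Set (ℝ × ℝ)).ncard := by
        rw [Set.ncard_coe_finset, List.toFinset_card_of_nodup hkeysnd]
      _ ≤ p := Set.ncard_le_ncard (fun v hv => ((hA.mem_iff v).1 (by simpa using hv)).1)
        hs.vertices_finite.1
  have hLmem : ∀ k v, v ∈ (L.val k).map Entry.v ↔ v ∈ vertices s ∧ v ∈ (s k).points := by
    intro k v
    rw [r1, List.mem_reverse, List.mem_map]
    constructor
    · rintro ⟨e, he, rfl⟩
      rw [List.mem_filter, decide_eq_true_eq] at he
      exact ⟨((hA.mem_iff _).1 (List.mem_map_of_mem he.1)).1, ((hA.through e he.1).2 k).1 he.2⟩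
    · rintro ⟨hv, hvk⟩
      obtain ⟨e, he, rfl⟩ := List.mem_map.1 ((hA.mem_iff v).2 ⟨hv, hq v hv⟩)
      exact ⟨e, by simpa using ⟨he, ((hA.through e he).2 k).2 hvk⟩, rfl⟩
  have hLnd : ∀ k, ((L.val k).map Entry.v).Nodup := by
    intro k
    rw [r1, List.nodup_reverse]
    exact hkeysnd.sublist (List.filter_sublist.map _)
  have hLlen : ∀ k, (L.val k).length = (A.filter fun e => k ∈ e.2).length := by
    intro k
    have := congrArg List.length (r1 k)
    simpa using this
  have hsum : ((List.finRange n).map fun k => (L.val k).length).sum = totalLength A := by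
    rw [← sum_length_filter A hAnd, Fin.sum_univ_def]
    simp only [hLlen]
  have hpts : ∀ k, ∀ e ∈ L.val k, e.v ∈ (s k).points := fun k e he =>
    ((hLmem k e.v).1 (List.mem_map_of_mem he)).2
  obtain ⟨-, t2, t3⟩ := sortAll_spec s p (List.finRange n) (List.nodup_finRange n) L.val
    (fun k _ => ⟨by
        rw [hLlen]
        exact (List.length_filter_le _ _).trans hAlen, (hLnd k).of_map, fun e he f hf hef h => hef
        (List.inj_on_of_nodup_map (hLnd k) he hf
          (eq_of_along_eq (hs.nondegenerate k) (hpts k e he) (hpts k f hf) h))⟩)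
  set L₂ := sortAll s (List.finRange n) L.val with hL₂
  obtain ⟨-, e2, e3⟩ := edgesAll_spec L₂.val (List.finRange n) (List.nodup_finRange n)
    (fun _ => [])
  constructor
  · intro k
    have hval : (procedureB s).val k = (edgesAll L₂.val (List.finRange n) fun _ => []).val k := rfl
    rw [hval, e2 k (List.mem_finRange k)]
    obtain ⟨g1, g2⟩ := t2 k (List.mem_finRange k)
    refine isOrderedEdgeList_zip_tail hs k (fun v => ?_) (List.pairwise_map.2 g1)
    rw [(g2.map Entry.v).mem_iff, hLmem]
  · have htime : (procedureB s).time = (procedureA s).time + (n + (L.time + (L₂.time + (n +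
        (edgesAll L₂.val (List.finRange n) fun _ => []).time)))) := rfl
    have h1 : ((List.finRange n).map fun k => (L₂.val k).length + 2).sum =
        totalLength A + 2 * n := by
      rw [← hsum]
      simp only [fun k => (t2 k (List.mem_finRange k)).2.length_eq]
      rw [List.sum_map_add]
      simp [mul_comm]
    have h2 : ((List.finRange n).map fun k =>
        (L.val k).length * (2 * heightBound p + 2) + 3).sum =
        totalLength A * (2 * heightBound p + 2) + 3 * n := by
      rw [← hsum, List.sum_map_add, List.sum_map_mul_right]
      simp [mul_comm]
    rw [h1] at e3
    rw [h2] at t3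
    have f1 : totalLength A * (2 * heightBound p + 2) ≤ 6 * p * (4 * H) :=
      Nat.mul_le_mul hW (by omega)
    have f2 : 6 * H * n ≤ 6 * H * (6 * p) := Nat.mul_le_mul_left _ hn
    have f3 : 6 * p * (4 * H) = 24 * (H * p) := by ring
    have f4 : 6 * H * (6 * p) = 36 * (H * p) := by ring
    have f5 : 210 * H * p = 210 * (H * p) := by ring
    have f6 : p ≤ H * p := Nat.le_mul_of_pos_left _ hH1
    have f7 : H ≤ H * p := Nat.le_mul_of_pos_right _ hp
    rw [← hpdef] at htA hW
    rw [htime, r2]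
    omega

/-- Tree heights are `O(log p)`. -/
theorem heightBound_le_log {p : ℕ} (hp : 2 ≤ p) :
    (heightBound (6 * p) : ℝ) ≤ 9 / Real.log 2 * Real.log p := by
  have h1 : Nat.log 2 (6 * p + 1) ≤ Nat.log 2 (p ^ 4) := by
    refine Nat.log_mono_right ?_
    have h2 : 2 ^ 3 ≤ p ^ 3 := Nat.pow_le_pow_left hp 3
    have h3 : p ^ 4 = p ^ 3 * p := by ring
    nlinarith
  have h2 : (Nat.log 2 (p ^ 4) : ℝ) ≤ Real.logb 2 ((p ^ 4 : ℕ) : ℝ) := by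
    exact_mod_cast Real.natLog_le_logb (p ^ 4) 2
  have h3 : Real.logb 2 ((p ^ 4 : ℕ) : ℝ) = 4 * Real.log p / Real.log 2 := by
    rw [Real.logb, Nat.cast_pow, Real.log_pow]
    norm_num
  have hlog2 : 0 < Real.log 2 := Real.log_pos (by norm_num)
  have h4 : 1 ≤ Real.log p / Real.log 2 := by
    rw [le_div_iff₀ hlog2, one_mul]
    exact Real.log_le_log (by norm_num) (by exact_mod_cast hp)
  have h5 : (Nat.log 2 (6 * p + 1) : ℝ) ≤ Nat.log 2 (p ^ 4) := by exact_mod_cast h1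
  have h6 : (heightBound (6 * p) : ℝ) = 2 * Nat.log 2 (6 * p + 1) + 1 := by
    unfold heightBound
    push_cast
    ring
  have h7 : 9 / Real.log 2 * Real.log p = 9 * (Real.log p / Real.log 2) := by ring
  have h8 : 4 * Real.log p / Real.log 2 = 4 * (Real.log p / Real.log 2) := by ring
  rw [h6, h7]
  rw [h3, h8] at h2
  linarith

end GuardSegments

theorem proposition2 :
    ∃ C : ℝ, ∀ (n : ℕ) (s : Fin n → GuardSegments.Segment ℝ),
      0 < n → GuardSegments.Admissible s →
        (∀ k : Fin n, GuardSegments.IsOrderedEdgeList s k ((GuardSegments.procedureB s).val k)) ∧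
        ((GuardSegments.procedureB s).time : ℝ) ≤
          C * (((GuardSegments.vertices s).ncard : ℝ) *
            Real.log ((GuardSegments.vertices s).ncard : ℝ)) := by
  refine ⟨400 * (9 / Real.log 2), fun n s hn hs => ?_⟩
  have hp : 2 ≤ (GuardSegments.vertices s).ncard := by
    have hlt := GuardSegments.Segment.lo_lt_hi (hs.nondegenerate ⟨0, hn⟩)
    rw [← Set.ncard_pair (a := (s ⟨0, hn⟩).lo) (b := (s ⟨0, hn⟩).hi)
      (fun h => hlt.ne (congrArg toLex h))]
    refine Set.ncard_le_ncard ?_ hs.vertices_finite.1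
    rintro v (rfl | rfl)
    · exact GuardSegments.lo_mem_vertices s _
    · exact GuardSegments.hi_mem_vertices s _
  obtain ⟨h1, h2⟩ := GuardSegments.procedureB_spec hs le_rfl (by omega)
  refine ⟨h1, ?_⟩
  have h3 := GuardSegments.heightBound_le_log hp
  have h4 : ((GuardSegments.procedureB s).time : ℝ) ≤
      400 * (GuardSegments.AVL.heightBound (6 * (GuardSegments.vertices s).ncard) *
        ((GuardSegments.vertices s).ncard : ℝ)) := by exact_mod_cast h2
  have h5 := mul_le_mul_of_nonneg_right h3 (Nat.cast_nonneg (GuardSegments.vertices s).ncard)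
  nlinarith
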